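/- Let $X$ be a finite-dimensional median graph, i.e. a connected graph in which any three vertices have a unique median point and such that the dimensions of the cubes contained in $X$ are bounded. Let $\mathrm{Isom}(X)$ be its group of graph automorphisms. A hyperplane of $X$ is a class of edges for the equivalence relation generated by being opposite in a $4$-cycle; the halfspaces it delimits are the connected components of the graph obtained from $X$ by removing its edges. An orientation of $X$ is a map sending every hyperplane to one of the halfspaces it delimits so that any two chosen halfspaces intersect; the Roller completion $\overline{X}$ is the graph whose vertices are the orientations and whose edges join two orientations that differ on exactly one hyperplane. A vertex $x$ is identified with the orientation choosing the halfspaces containing $x$, and the Roller boundary is $\mathfrak{R}X = \overline{X}\setminus X$, where $X$ is the component of the principal orientations. A component $Y \subset \mathfrak{R}X$ lies in a halfspace $D$ if all its orientations choose $D$, and a direction to $Y$ is a sequence of halfspaces $D_1 \supsetneq D_2 \supsetneq \cdots$ all containing $Y$. For components $Y,Z\subset\mathfrak{R}X$, write $Z \prec Y$ if every direction to $Z$ is also a direction to $Y$. Fix a component $Y\subset\mathfrak{R}X$. Let $\mathcal{Y}$ be the set of the components $Z \subset \mathfrak{R}X$ satisfying $Z \prec Y$, let $\mathrm{stab}(Y)$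 be the stabiliser of $Y$ in $\mathrm{Isom}(X)$, and let $\mathrm{stab}_0(Y)$ be the subgroup of $\mathrm{stab}(Y)$ stabilising each component in $\mathcal{Y}$. Fix a vertex $x \in X$. For every component $Z\subset\mathfrak{R}X$, let $\mathcal{W}(x|Z)$ denote the set of the hyperplanes separating $x$ from $Z$, and define the morphism $\mathfrak{h}_Z : \mathrm{stab}(Z) \to \mathbb{Z}$ by $$\mathfrak{h}_Z(g) = |\mathcal{W}(x|Z) \setminus g\mathcal{W}(x|Z)| - |g\mathcal{W}(x|Z) \setminus \mathcal{W}(x|Z)|.$$ The full horomorphism of $Y$ is $\mathfrak{H}_Y : \mathrm{stab}_0(Y) \to \mathbb{Z}^{\mathcal{Y}}$, $g \mapsto (\mathfrak{h}_Z(g))_{Z \in \mathcal{Y}}$. Then the set $\mathcal{Y}$ is finite, $\mathrm{stab}_0(Y)$ has finite index in $\mathrm{stab}(Y)$, and, whatever the choice of $x$, an element $g \in \ker(\mathfrak{H}_Y)$ is $X$-elliptic (the orbits of $\langle g \rangle$ in $X$ are bounded) if and only if it is $Y$-elliptic (the orbits of $\langle g \rangle$ in the graph $Y$ are bounded). -/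

import Mathlib

namespace MedianRoller

open scoped Pointwise

/-! ### Median graphs, cubes and dimension -/

/-- The interval `I(x, y)`: the vertices lying on a geodesic between `x` and `y`. -/
def interval {V : Type*} (G : SimpleGraph V) (x y : V) : Set V :=
  {m | G.dist x m + G.dist m y = G.dist x y}

/-- A median graph: a (nonempty) connected graph in which every triple of vertices has a unique
median point. -/
structure IsMedian {V : Type*} (G : SimpleGraph V) : Prop where
  connected : G.Connected
  existsUnique_median : ∀ x y z : V,
    ∃! m, m ∈ interval G x y ∧ m ∈ interval G y z ∧ m ∈ interval G x z

/-- The one-skeleton of the `d`-dimensional cube: two vertices are adjacent when they differ in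
exactly one coordinate. -/
def cubeGraph (d : ℕ) : SimpleGraph (Fin d → Bool) where
  Adj u v := ∃! i, u i ≠ v i
  symm := ⟨fun u v h => by simpa only [ne_comm] using h⟩
  loopless := ⟨fun u h => by obtain ⟨i, hi, -⟩ := h; exact hi rfl⟩

/-- The dimension is finite: there is a bound on the dimensions of the cubes of `G`. -/
def IsFiniteDimensional {V : Type*} (G : SimpleGraph V) : Prop :=
  ∃ n : ℕ, ∀ d : ℕ, Nonempty (cubeGraph d ↪g G) → d ≤ n

/-! ### Hyperplanes and halfspaces -/

/-- `e` and `f` are opposite edges of some 4-cycle `a, b, c, d`. -/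
def Opposite {V : Type*} (G : SimpleGraph V) (e f : Sym2 V) : Prop :=
  ∃ a b c d : V, G.Adj a b ∧ G.Adj b c ∧ G.Adj c d ∧ G.Adj d a ∧ a ≠ c ∧ b ≠ d ∧
    e = s(a, b) ∧ f = s(c, d)

/-- The class of `e` for the equivalence relation generated by `Opposite`. -/
def edgeClass {V : Type*} (G : SimpleGraph V) (e : Sym2 V) : Set (Sym2 V) :=
  {f | Relation.EqvGen (Opposite G) e f}

/-- A hyperplane: a class of edges, for the equivalence relation generated by being opposite in
a 4-cycle. -/
def Hyperplane {V : Type*} (G : SimpleGraph V) : Type _ :=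
  {J : Set (Sym2 V) // ∃ e ∈ G.edgeSet, J = edgeClass G e}

/-- The halfspaces delimited by `J`: the connected components of the graph obtained by removing
(the interiors of) the edges of `J`. -/
def Hyperplane.halfspaces {V : Type*} {G : SimpleGraph V} (J : Hyperplane G) : Set (Set V) :=
  Set.range fun c : (G.deleteEdges J.1).ConnectedComponent => c.supp

/-- `D` is a halfspace of `G`. -/
def IsHalfspace {V : Type*} (G : SimpleGraph V) (D : Set V) : Prop :=
  ∃ J : Hyperplane G, D ∈ J.halfspaces

/-! ### The Roller completion -/

/-- An orientation: a choice, for every hyperplane, of one of the halfspaces it delimits, such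
that any two chosen halfspaces intersect. -/
@[ext]
structure Orientation {V : Type*} (G : SimpleGraph V) where
  side : Hyperplane G → Set V
  side_mem : ∀ J, side J ∈ J.halfspaces
  inter_nonempty : ∀ J K, (side J ∩ side K).Nonempty

/-- The principal orientation given by a vertex `x`. -/
def principal {V : Type*} (G : SimpleGraph V) (x : V) : Orientation G where
  side J := ((G.deleteEdges J.1).connectedComponentMk x).supp
  side_mem _ := ⟨_, rfl⟩
  inter_nonempty _ _ := ⟨x, rfl, rfl⟩

/-- The one-skeleton of the Roller completion: two orientations are adjacent when they differ on
a single hyperplane. -/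
def rollerGraph {V : Type*} (G : SimpleGraph V) : SimpleGraph (Orientation G) where
  Adj σ τ := ∃! J, σ.side J ≠ τ.side J
  symm := ⟨fun σ τ h => by simpa only [ne_comm] using h⟩
  loopless := ⟨fun σ h => by obtain ⟨i, hi, -⟩ := h; exact hi rfl⟩

/-- The components of the Roller completion. -/
abbrev Component {V : Type*} (G : SimpleGraph V) : Type _ :=
  (rollerGraph G).ConnectedComponent

/-- The component `Y` lies in the Roller boundary, i.e. it is not the component containing the
principal orientations. -/
def IsBoundary {V : Type*} {G : SimpleGraph V} (Y : Component G) : Prop :=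
  ∀ x : V, principal G x ∉ Y.supp

/-- The component `Y` is contained in the halfspace `D` (identified with the set of the
orientations choosing `D`). -/
def ContainedIn {V : Type*} {G : SimpleGraph V} (Y : Component G) (D : Set V) : Prop :=
  ∀ σ ∈ Y.supp, ∃ J, σ.side J = D

/-- A direction to `Y`: a strictly decreasing sequence of halfspaces, all containing `Y`. -/
def IsDirectionTo {V : Type*} {G : SimpleGraph V} (D : ℕ → Set V) (Y : Component G) : Prop :=
  StrictAnti D ∧ (∀ i, IsHalfspace G (D i)) ∧ ∀ i, ContainedIn Y (D i)

/-- `Y ≺ Z`: every direction to `Y` is also a direction to `Z`. -/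
def Prec {V : Type*} {G : SimpleGraph V} (Y Z : Component G) : Prop :=
  ∀ D : ℕ → Set V, IsDirectionTo D Y → IsDirectionTo D Z

/-- The set `𝒴` of the components `Z` of the Roller boundary satisfying `Z ≺ Y`. -/
def precSet {V : Type*} {G : SimpleGraph V} (Y : Component G) : Set (Component G) :=
  {Z | IsBoundary Z ∧ Prec Z Y}

/-! ### The action of the isometry group

The isometry group is the automorphism group `G ≃g G` of the graph. -/

theorem Opposite.map {V : Type*} {G : SimpleGraph V} (g : G ≃g G) {e f : Sym2 V}
    (h : Opposite G e f) : Opposite G (e.map g) (f.map g) := by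
  obtain ⟨a, b, c, d, h1, h2, h3, h4, h5, h6, rfl, rfl⟩ := h
  exact ⟨g a, g b, g c, g d, g.map_adj_iff.2 h1, g.map_adj_iff.2 h2, g.map_adj_iff.2 h3,
    g.map_adj_iff.2 h4, g.injective.ne h5, g.injective.ne h6, rfl, rfl⟩

theorem edgeClass_map {V : Type*} {G : SimpleGraph V} (g : G ≃g G) {e f : Sym2 V}
    (h : Relation.EqvGen (Opposite G) e f) :
    Relation.EqvGen (Opposite G) (e.map g) (f.map g) := by
  induction h with
  | rel _ _ h => exact .rel _ _ (h.map g)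
  | refl _ => exact .refl _
  | symm _ _ _ ih => exact .symm _ _ ih
  | trans _ _ _ _ _ ih1 ih2 => exact .trans _ _ _ ih1 ih2

theorem sym2_map_mul {V : Type*} {G : SimpleGraph V} (g h : G ≃g G) (e : Sym2 V) :
    e.map (g * h : G ≃g G) = (e.map h).map g := by
  rw [Sym2.map_map]; rfl

theorem sym2_map_one {V : Type*} {G : SimpleGraph V} (e : Sym2 V) :
    e.map (1 : G ≃g G) = e :=
  congrFun Sym2.map_id e

theorem image_edgeClass {V : Type*} {G : SimpleGraph V} (g : G ≃g G) (e : Sym2 V) :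
    Sym2.map g '' edgeClass G e = edgeClass G (e.map g) := by
  ext f
  constructor
  · rintro ⟨f, hf, rfl⟩
    exact edgeClass_map g hf
  · intro hf
    refine ⟨f.map (g⁻¹ : G ≃g G), ?_, ?_⟩
    · have := edgeClass_map g⁻¹ hf
      rwa [← sym2_map_mul, inv_mul_cancel, sym2_map_one] at this
    · rw [← sym2_map_mul, mul_inv_cancel, sym2_map_one]

/-- An isometry sends a hyperplane to its image. -/
instance {V : Type*} {G : SimpleGraph V} : MulAction (G ≃g G) (Hyperplane G) where
  smul g J := ⟨Sym2.map g '' J.1, by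
    obtain ⟨e, he, hJ⟩ := J.2
    refine ⟨e.map g, ?_, by rw [hJ, image_edgeClass]⟩
    induction e with | _ a b => exact g.map_adj_iff.2 he⟩
  one_smul J := Subtype.ext <| by
    change Sym2.map (1 : G ≃g G) '' J.1 = J.1
    simp
  mul_smul g h J := Subtype.ext <| by
    change Sym2.map (g * h : G ≃g G) '' J.1 = Sym2.map g '' (Sym2.map h '' J.1)
    simp only [Set.image_image, sym2_map_mul]

/-- An isometry maps the complement of a hyperplane to the complement of its image. -/
def deleteIso {V : Type*} {G : SimpleGraph V} (g : G ≃g G) (J : Hyperplane G) :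
    G.deleteEdges J.1 ≃g G.deleteEdges (g • J).1 where
  toEquiv := g.toEquiv
  map_rel_iff' := by
    intro a b
    change (G.deleteEdges (Sym2.map g '' J.1)).Adj (g a) (g b) ↔ _
    have : s(g a, g b) = Sym2.map g s(a, b) := rfl
    rw [SimpleGraph.deleteEdges_adj, SimpleGraph.deleteEdges_adj, g.map_adj_iff, this,
      (Sym2.map.injective g.injective).mem_set_image]

theorem image_mem_halfspaces {V : Type*} {G : SimpleGraph V} (g : G ≃g G) {J : Hyperplane G}
    {D : Set V} (h : D ∈ J.halfspaces) : g '' D ∈ (g • J).halfspaces := by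
  obtain ⟨c, rfl⟩ := h
  induction c using SimpleGraph.ConnectedComponent.ind with | _ x =>
  refine ⟨(G.deleteEdges (g • J).1).connectedComponentMk (g x), ?_⟩
  ext y
  obtain ⟨y, rfl⟩ := g.surjective y
  rw [g.injective.mem_set_image]
  simp only [SimpleGraph.ConnectedComponent.mem_supp_iff, SimpleGraph.ConnectedComponent.eq]
  exact (deleteIso g J).reachable_iff

/-- An isometry `g` acts on orientations by `(g • σ)(g J) = g σ(J)`. -/
instance {V : Type*} {G : SimpleGraph V} : MulAction (G ≃g G) (Orientation G) where
  smul g σ :=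
    { side := fun J => g '' σ.side (g⁻¹ • J)
      side_mem := fun J => by
        simpa using image_mem_halfspaces g (σ.side_mem (g⁻¹ • J))
      inter_nonempty := fun J K => by
        rw [← Set.image_inter g.injective]
        exact (σ.inter_nonempty _ _).image _ }
  one_smul σ := Orientation.ext <| funext fun J => by
    change (1 : G ≃g G) '' σ.side ((1 : G ≃g G)⁻¹ • J) = σ.side J
    rw [inv_one, one_smul]
    exact Set.image_id _
  mul_smul g h σ := Orientation.ext <| funext fun J => by
    change (g * h : G ≃g G) '' σ.side ((g * h : G ≃g G)⁻¹ • J) =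
      g '' (h '' σ.side (h⁻¹ • g⁻¹ • J))
    rw [mul_inv_rev, mul_smul, Set.image_image]
    rfl

theorem smul_side {V : Type*} {G : SimpleGraph V} (g : G ≃g G) (σ : Orientation G)
    (J : Hyperplane G) : (g • σ).side J = g '' σ.side (g⁻¹ • J) := rfl

theorem smul_side_smul {V : Type*} {G : SimpleGraph V} (g : G ≃g G) (σ : Orientation G)
    (J : Hyperplane G) : (g • σ).side (g • J) = g '' σ.side J := by
  rw [smul_side, inv_smul_smul]

/-- The automorphism of the Roller completion induced by an isometry. -/
def rollerHom {V : Type*} {G : SimpleGraph V} (g : G ≃g G) : rollerGraph G →g rollerGraph G where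
  toFun σ := g • σ
  map_rel' := by
    rintro σ τ ⟨J, hJ, hu⟩
    refine ⟨g • J, ?_, fun K hK => ?_⟩
    · simpa only [smul_side_smul, ne_eq, g.injective.image_injective.eq_iff] using hJ
    · rw [← hu (g⁻¹ • K) (fun h => hK (by rw [smul_side, smul_side, h])), smul_inv_smul]

/-- An isometry permutes the components of the Roller completion. -/
instance {V : Type*} {G : SimpleGraph V} : MulAction (G ≃g G) (Component G) where
  smul g Y := Y.map (rollerHom g)
  one_smul Y := by
    induction Y using SimpleGraph.ConnectedComponent.ind with | _ σ =>
    exact congrArg (rollerGraph G).connectedComponentMk (one_smul (G ≃g G) σ)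
  mul_smul g h Y := by
    induction Y using SimpleGraph.ConnectedComponent.ind with | _ σ =>
    exact congrArg (rollerGraph G).connectedComponentMk (mul_smul g h σ)

theorem smul_mem_supp {V : Type*} {G : SimpleGraph V} (g : G ≃g G) {Y : Component G}
    {σ : Orientation G} (h : σ ∈ Y.supp) : g • σ ∈ (g • Y).supp := by
  rw [SimpleGraph.ConnectedComponent.mem_supp_iff] at h ⊢
  rw [← h]
  rfl

/-- The stabiliser `stab(Y)` of a component in the isometry group. -/
abbrev stab {V : Type*} {G : SimpleGraph V} (Y : Component G) : Subgroup (G ≃g G) :=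
  MulAction.stabilizer (G ≃g G) Y

/-- The subgroup `stab₀(Y)` of `stab(Y)` stabilising every component in `𝒴`. -/
def stab₀ {V : Type*} {G : SimpleGraph V} (Y : Component G) : Subgroup (G ≃g G) :=
  stab Y ⊓ ⨅ Z ∈ precSet Y, stab Z

theorem stab₀_le {V : Type*} {G : SimpleGraph V} {Y Z : Component G} (hZ : Z ∈ precSet Y) :
    stab₀ Y ≤ stab Z :=
  inf_le_right.trans (iInf₂_le Z hZ)

/-! ### Elliptic isometries -/

/-- The isometry `g` is elliptic on the vertex set: its orbits are bounded. -/
def IsElliptic {V : Type*} {G : SimpleGraph V} (g : G ≃g G) : Prop :=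
  ∀ x : V, ∃ N : ℕ, ∀ n : ℤ, G.dist x ((g ^ n) • x) ≤ N

/-- An isometry `g` stabilising the component `Y` is `Y`-elliptic: its orbits in `Y` are bounded,
with respect to the graph metric of `Y`. -/
def IsEllipticOn {V : Type*} {G : SimpleGraph V} (g : G ≃g G) (Y : Component G) : Prop :=
  ∀ σ ∈ Y.supp, ∃ N : ℕ, ∀ n : ℤ, (rollerGraph G).dist σ ((g ^ n) • σ) ≤ N

/-! ### Horomorphisms -/

/-- The set `𝒲(x|Y)` of the hyperplanes separating the vertex `x` from the component `Y`. -/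
def separating {V : Type*} {G : SimpleGraph V} (x : V) (Y : Component G) :
    Set (Hyperplane G) :=
  {J | ∃ D ∈ J.halfspaces, x ∉ D ∧ ∀ σ ∈ Y.supp, σ.side J = D}

/-- `|A \ B| - |B \ A|`, for two sets `A` and `B` whose differences are finite. -/
noncomputable def transfer {α : Type*} (A B : Set α) : ℤ :=
  ((A \ B).ncard : ℤ) - ((B \ A).ncard : ℤ)

theorem transfer_add {α : Type*} {A B C : Set α} (h1 : (A \ B).Finite) (h2 : (B \ A).Finite)
    (h3 : (B \ C).Finite) (h4 : (C \ B).Finite) :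
    transfer A B + transfer B C = transfer A C := by
  have key : ∀ {P Q R : Set α}, (P \ Q).Finite → (Q \ R).Finite →
      (P \ R).Finite := fun {P Q R} hP hQ => (hP.union hQ).subset fun a ha => by
    by_cases haQ : a ∈ Q
    · exact Or.inr ⟨haQ, ha.2⟩
    · exact Or.inl ⟨ha.1, haQ⟩
  have split : ∀ {P Q R : Set α}, (P \ Q).Finite →
      (P \ Q).ncard = ((P ∩ R) \ Q).ncard + (P \ (Q ∪ R)).ncard := fun {P Q R} hP => by
    rw [← Set.ncard_inter_add_ncard_sdiff_eq_ncard (P \ Q) R hP]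
    congr 2 <;> ext a <;> simp only [Set.mem_inter_iff, Set.mem_sdiff, Set.mem_union] <;> tauto
  unfold transfer
  rw [split (R := C) h1, split (R := C) h2, split (R := A) h3, split (R := A) h4,
    split (R := B) (key h1 h3), split (R := B) (key h4 h2), Set.inter_comm A C,
    Set.inter_comm B C, Set.inter_comm B A, Set.union_comm B C, Set.union_comm A C,
    Set.union_comm B A]
  push_cast
  ring

theorem transfer_smul {Γ α : Type*} [Group Γ] [MulAction Γ α] (g : Γ) (A B : Set α) :
    transfer (g • A) (g • B) = transfer A B := by
  unfold transfer
  rw [← Set.smul_set_sdiff, ← Set.smul_set_sdiff, Set.ncard_smul_set, Set.ncard_smul_set]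

/-- In a connected graph only finitely many hyperplanes separate two vertices. -/
theorem finite_not_reachable {V : Type*} {G : SimpleGraph V} (hG : G.Connected) (x y : V) :
    {J : Hyperplane G | ¬ (G.deleteEdges J.1).Reachable x y}.Finite := by
  obtain ⟨p⟩ := hG.preconnected x y
  induction p with
  | nil => exact Set.finite_empty.subset fun J hJ => hJ .rfl
  | @cons u v w h p ih =>
    refine (ih.union (Set.finite_singleton
      (⟨edgeClass G s(u, v), s(u, v), h, rfl⟩ : Hyperplane G))).subset fun J hJ => ?_
    by_cases he : s(u, v) ∈ J.1
    · refine Or.inr (Subtype.ext ?_)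
      obtain ⟨e, -, hJe⟩ := J.2
      rw [hJe] at he ⊢
      ext f
      exact ⟨fun hf => .trans _ _ _ (.symm _ _ he) hf, fun hf => .trans _ _ _ he hf⟩
    · refine Or.inl fun hr => hJ (SimpleGraph.Reachable.trans ?_ hr)
      exact (SimpleGraph.deleteEdges_adj.2 ⟨h, he⟩).reachable

theorem separating_sdiff_finite {V : Type*} {G : SimpleGraph V} (hG : G.Connected) (x y : V)
    (Y : Component G) : (separating x Y \ separating y Y).Finite := by
  refine (finite_not_reachable hG x y).subset ?_
  rintro J ⟨⟨D, hD, hx, hY⟩, hy⟩ hr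
  refine hy ⟨D, hD, fun hyD => hx ?_, hY⟩
  obtain ⟨c, rfl⟩ := hD
  exact (SimpleGraph.ConnectedComponent.eq.2 hr).trans hyD

theorem smul_separating_subset {V : Type*} {G : SimpleGraph V} (g : G ≃g G) (x : V)
    (Y : Component G) : g • separating x Y ⊆ separating (g • x) (g • Y) := by
  rintro _ ⟨J, ⟨D, hD, hx, hY⟩, rfl⟩
  refine ⟨g '' D, image_mem_halfspaces g hD, ?_, fun σ hσ => ?_⟩
  · rintro ⟨y, hy, hyx⟩
    exact hx (g.injective hyx ▸ hy)
  · have := smul_mem_supp g⁻¹ hσ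
    rw [inv_smul_smul] at this
    change σ.side (g • J) = _
    rw [← hY _ this, ← smul_side_smul, smul_inv_smul]

theorem smul_separating {V : Type*} {G : SimpleGraph V} (g : G ≃g G) (x : V)
    (Y : Component G) : g • separating x Y = separating (g • x) (g • Y) := by
  refine (smul_separating_subset g x Y).antisymm ?_
  rw [Set.subset_smul_set_iff]
  simpa using smul_separating_subset g⁻¹ (g • x) (g • Y)

/-- The horomorphism `stab(Y) → ℤ` of a component `Y`, computed from the vertex `x`:
`g ↦ |𝒲(x|Y) \ g 𝒲(x|Y)| - |g 𝒲(x|Y) \ 𝒲(x|Y)|`. -/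
noncomputable def horomorphism {V : Type*} {G : SimpleGraph V} (hG : G.Connected) (x : V)
    (Y : Component G) : stab Y →* Multiplicative ℤ :=
  MonoidHom.mk'
    (fun g => Multiplicative.ofAdd
      (transfer (separating x Y) ((g : G ≃g G) • separating x Y)))
    (by
      rintro ⟨g, hg⟩ ⟨h, hh⟩
      rw [MulAction.mem_stabilizer_iff] at hg hh
      rw [← ofAdd_add]
      congr 1
      change transfer (separating x Y) ((g * h) • separating x Y) = _
      rw [← transfer_smul g (separating x Y) (h • separating x Y), ← mul_smul]
      have e1 : g • separating x Y = separating (g • x) Y := by rw [smul_separating, hg]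
      have e2 : (g * h) • separating x Y = separating ((g * h) • x) Y := by
        rw [smul_separating, mul_smul g h Y, hh, hg]
      change _ = transfer (separating x Y) (g • separating x Y) + _
      rw [e1, e2]
      exact (transfer_add (separating_sdiff_finite hG _ _ Y) (separating_sdiff_finite hG _ _ Y)
        (separating_sdiff_finite hG _ _ Y) (separating_sdiff_finite hG _ _ Y)).symm)

/-- The full horomorphism `stab₀(Y) → ℤ^𝒴`, `g ↦ (𝔥_Z(g))_{Z ∈ 𝒴}`. -/
noncomputable def fullHoromorphism {V : Type*} {G : SimpleGraph V} (hG : G.Connected) (x : V)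
    (Y : Component G) : stab₀ Y →* (precSet Y → Multiplicative ℤ) :=
  MonoidHom.pi fun Z =>
    (horomorphism hG x (Z : Component G)).comp (Subgroup.inclusion (stab₀_le Z.2))

end MedianRoller

/-! Fix `x`, and let P be the set of halfspaces containing `Y` but not `x`, ordered by inclusion. It
is narrow: only finitely many of its elements lie above a given one, since finitely many halfspaces
separate two vertices, and its antichains are bounded by the dimension, since an antichain of
halfspaces chosen by one orientation and avoiding `x` spans a cube (`IsMedian.exists_cube`).

Order theory takes over. A narrow set is a finite union of atoms, pieces that no upper set cuts into
two infinite parts (`NarrowSet.exists_atoms`), so it has finitely many upper sets up to finite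
differences. The components `Z ≺ Y` correspond to the infinite upper sets modulo finite differences:
`Z` gives the halfspaces containing `Z` and `Y` but not `x`, and an infinite upper set I gives the
component of the orientation that follows `Y` on I and points to `x` elsewhere
(`IsMedian.exists_mem_precSet`). Hence `precSet Y` is finite, and the finite index follows from the
finiteness of orbits.

For g in the kernel, this dictionary says that g moves every upper set I of P by a finite amount
with as many elements gained as lost. On an atom, the number of elements above D is then g-invariant
for almost all D; its superlevel sets are cofinite with finite levels, so one of them is invariant
(`exists_smul_eq_self_of_directed`). Thus some cofinite F ⊆ P satisfies gF = F.

Distances in `X` and in `Y` both count separating hyperplanes. For σ in `Y`, a hyperplane counted in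
only one of d(x, hx) and d(σ, hσ), with h a power of g, comes from a fixed finite set or its
h-translate (`IsMedian.sep_subset_of_mem_stab`, `IsMedian.sep_principal_subset`). So the two
displacements differ by a bounded amount; F is what controls d(x, hx) by d(σ, hσ). -/

namespace MedianRoller

open scoped Pointwise

/-! ### Halfspaces and separating hyperplanes, in the graph and in its Roller completion. -/

section Geometry

variable {V : Type*} {G : SimpleGraph V}

/-! ### Geodesics in median graphs -/

theorem exists_adj_dist_eq (hG : G.Connected) {u w : V} {k : ℕ} (h : G.dist u w = k + 1) :
    ∃ u', G.Adj u u' ∧ G.dist u' w = k := by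
  obtain ⟨p, hp⟩ := hG.exists_walk_length_eq_dist u w
  cases p with
  | nil => simp at h
  | @cons _ v _ hadj q =>
    refine ⟨v, hadj, ?_⟩
    have h1 := SimpleGraph.dist_le q
    have h2 := hG.dist_triangle (u := u) (v := v) (w := w)
    rw [SimpleGraph.dist_eq_one_iff_adj.2 hadj] at h2
    rw [SimpleGraph.Walk.length_cons] at hp
    omega

/-- The median of `a`, `b`, `z` lies on the edge `ab`, hence is `a` or `b`; that endpoint is between
the other one and `z`. -/
theorem IsMedian.dist_adj (hG : IsMedian G) {a b : V} (h : G.Adj a b) (z : V) :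
    G.dist z b = G.dist z a + 1 ∨ G.dist z a = G.dist z b + 1 := by
  obtain ⟨m, ⟨h1, h2, h3⟩, -⟩ := hG.existsUnique_median a b z
  simp only [interval, Set.mem_ofPred_eq] at h1 h2 h3
  have h' := SimpleGraph.dist_eq_one_iff_adj.2 h
  have c : ∀ u v, G.dist u v = G.dist v u := fun _ _ => SimpleGraph.dist_comm
  rcases Nat.eq_zero_or_pos (G.dist a m) with h0 | h0
  · rw [hG.connected.dist_eq_zero_iff] at h0
    subst h0
    have := c b a
    have := c b z
    have := c a z
    omega
  · have h0 : G.dist m b = 0 := by omega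
    rw [hG.connected.dist_eq_zero_iff] at h0
    subst h0
    have := c m z
    have := c a z
    omega

/-- The vertices closer to `a` than to `b`. -/
def closer (G : SimpleGraph V) (a b : V) : Set V := {v | G.dist v a < G.dist v b}

theorem IsMedian.compl_closer (hG : IsMedian G) {a b : V} (h : G.Adj a b) :
    (closer G a b)ᶜ = closer G b a := by
  ext v
  have := hG.dist_adj h v
  simp only [closer, Set.mem_compl_iff, Set.mem_ofPred_eq]
  omega

theorem IsMedian.mem_closer (hG : IsMedian G) {a b : V} (h : G.Adj a b) {v : V} :
    v ∈ closer G a b ↔ G.dist v b = G.dist v a + 1 := by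
  have := hG.dist_adj h v
  simp only [closer, Set.mem_ofPred_eq]
  omega

theorem left_mem_closer {a b : V} (h : G.Adj a b) : a ∈ closer G a b := by
  simp [closer, SimpleGraph.dist_eq_one_iff_adj.2 h]

/-- Were `v` on opposite sides of the two edges, both `a` and `c` would be medians of `b`, `d`, `v`.
-/
theorem IsMedian.closer_square_subset (hG : IsMedian G) {a b c d : V} (hab : G.Adj a b)
    (hbc : G.Adj b c) (hcd : G.Adj c d) (hda : G.Adj d a) (hac : a ≠ c) (hbd : b ≠ d) :
    closer G a b ⊆ closer G d c := by
  intro v hv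
  by_contra hv'
  rw [hG.mem_closer hab] at hv
  have h4 := hG.dist_adj hda v
  have h3 := hG.dist_adj hcd v
  have h2 := hG.dist_adj hbc v
  have h5 : ¬ G.dist v d < G.dist v c := hv'
  have h6 : G.dist b d = 2 := by
    have t := hG.connected.dist_triangle (u := b) (v := a) (w := d)
    have e1 := SimpleGraph.dist_eq_one_iff_adj.2 hab.symm
    have e2 := SimpleGraph.dist_eq_one_iff_adj.2 hda.symm
    have e3 := hG.dist_adj hda b
    have e4 := hG.connected.pos_dist_of_ne hbd
    omega
  have h7 : ∀ u v, G.dist u v = G.dist v u := fun _ _ => SimpleGraph.dist_comm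
  refine hac ((hG.existsUnique_median b d v).unique ⟨?_, ?_, ?_⟩ ⟨?_, ?_, ?_⟩) <;>
    simp only [interval, Set.mem_ofPred_eq]
  · rw [SimpleGraph.dist_eq_one_iff_adj.2 hab.symm, SimpleGraph.dist_eq_one_iff_adj.2 hda.symm, h6]
  · rw [SimpleGraph.dist_eq_one_iff_adj.2 hda, h7 a, h7 d]; omega
  · rw [SimpleGraph.dist_eq_one_iff_adj.2 hab.symm, h7 a, h7 b]; omega
  · rw [SimpleGraph.dist_eq_one_iff_adj.2 hbc, SimpleGraph.dist_eq_one_iff_adj.2 hcd, h6]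
  · rw [SimpleGraph.dist_eq_one_iff_adj.2 hcd.symm, h7 c, h7 d]; omega
  · rw [SimpleGraph.dist_eq_one_iff_adj.2 hbc, h7 c, h7 b]; omega

theorem IsMedian.closer_square (hG : IsMedian G) {a b c d : V} (hab : G.Adj a b)
    (hbc : G.Adj b c) (hcd : G.Adj c d) (hda : G.Adj d a) (hac : a ≠ c) (hbd : b ≠ d) :
    closer G a b = closer G d c :=
  (hG.closer_square_subset hab hbc hcd hda hac hbd).antisymm
    (hG.closer_square_subset hcd.symm hbc.symm hab.symm hda.symm hbd.symm hac.symm)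

/-- An edge with exactly one endpoint in `closer G a b` is square-equivalent to the edge `ab`. -/
theorem IsMedian.eqvGen_of_crossing (hG : IsMedian G) {a b : V} (hab : G.Adj a b) :
    ∀ {u v : V}, G.Adj u v → u ∈ closer G a b → v ∈ closer G b a →
      Relation.EqvGen (Opposite G) s(a, b) s(u, v) := by
  suffices h : ∀ (k : ℕ) {u v : V}, G.dist u a = k → G.Adj u v → u ∈ closer G a b →
      v ∈ closer G b a → Relation.EqvGen (Opposite G) s(a, b) s(u, v) from
    fun {_ _} huv hu hv => h _ rfl huv hu hv
  intro k
  have cm : ∀ u v, G.dist u v = G.dist v u := fun _ _ => SimpleGraph.dist_comm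
  induction k with
  | zero =>
    intro u v hk huv hu hv
    rw [hG.connected.dist_eq_zero_iff] at hk
    subst hk
    rw [hG.mem_closer hab.symm, cm v u, SimpleGraph.dist_eq_one_iff_adj.2 huv] at hv
    have : G.dist v b = 0 := by omega
    rw [hG.connected.dist_eq_zero_iff] at this
    subst this
    exact .refl _
  | succ k ih =>
    intro u v hk huv hu hv
    rw [hG.mem_closer hab] at hu
    rw [hG.mem_closer hab.symm] at hv
    obtain ⟨u', huu', hu'a⟩ := exists_adj_dist_eq hG.connected hk
    have e1 := hG.dist_adj huv a
    have e2 := hG.dist_adj huv b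
    have e3 := hG.dist_adj huu' b
    have e4 := hG.dist_adj hab u'
    rw [cm a u, cm a v] at e1
    rw [cm b u, cm b v] at e2
    rw [cm b u, cm b u'] at e3
    have hvb : G.dist v b = k + 1 := by omega
    have hu'b : G.dist u' b = k + 1 := by omega
    have hne : u' ≠ v := by rintro rfl; omega
    have hd2 : G.dist u' v = 2 := by
      have t := hG.connected.dist_triangle (u := u') (v := u) (w := v)
      have f1 := SimpleGraph.dist_eq_one_iff_adj.2 huu'.symm
      have f2 := SimpleGraph.dist_eq_one_iff_adj.2 huv
      have f3 := hG.dist_adj huv u'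
      have f4 := hG.connected.pos_dist_of_ne hne
      omega
    obtain ⟨m, ⟨h1, h2, h3⟩, -⟩ := hG.existsUnique_median u' v b
    simp only [interval, Set.mem_ofPred_eq] at h1 h2 h3
    rw [cm m v] at h1
    have hu'm : G.Adj u' m := SimpleGraph.dist_eq_one_iff_adj.1 (by omega)
    have hvm : G.Adj v m := SimpleGraph.dist_eq_one_iff_adj.1 (by omega)
    have hmb : G.dist m b = k := by omega
    have g1 := hG.dist_adj hab m
    have g2 := hG.dist_adj hu'm a
    have g3 := hG.dist_adj hvm a
    have c1 := cm a m
    have c2 := cm a u'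
    have c3 := cm a v
    refine .trans _ _ _ (ih hu'a hu'm ?_ ?_) (.rel _ _ ?_)
    · rw [hG.mem_closer hab]; omega
    · rw [hG.mem_closer hab.symm]; omega
    · refine ⟨u', m, v, u, hu'm, hvm.symm, huv.symm, huu', hne, ?_, rfl, Sym2.eq_swap⟩
      rintro rfl
      omega

/-- The pair of sides of an edge. -/
def sides (G : SimpleGraph V) (a b : V) : Set (Set V) := {closer G a b, closer G b a}

theorem IsMedian.sides_eq_of_eqvGen (hG : IsMedian G) {e f : Sym2 V}
    (h : Relation.EqvGen (Opposite G) e f) (he : e ∈ G.edgeSet) :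
    f ∈ G.edgeSet ∧ ∀ a b c d, e = s(a, b) → f = s(c, d) → sides G a b = sides G c d := by
  have swap : ∀ a b, sides G a b = sides G b a := fun a b => Set.pair_comm _ _
  have refl : ∀ e : Sym2 V, ∀ a b c d, e = s(a, b) → e = s(c, d) → sides G a b = sides G c d := by
    rintro _ a b c d rfl h
    rcases Sym2.eq_iff.1 h with ⟨rfl, rfl⟩ | ⟨rfl, rfl⟩
    · rfl
    · exact swap _ _
  -- Edge membership is carried as an equivalence so that the symmetric case of the induction goes
  -- through.
  have aux : (e ∈ G.edgeSet ↔ f ∈ G.edgeSet) ∧ (e ∈ G.edgeSet → ∀ a b c d, e = s(a, b) →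
      f = s(c, d) → sides G a b = sides G c d) := by
    clear he
    induction h with
    | rel e f h =>
      obtain ⟨a, b, c, d, h1, h2, h3, h4, h5, h6, rfl, rfl⟩ := h
      refine ⟨⟨fun _ => h3, fun _ => h1⟩, fun _ a' b' c' d' e1 e2 => ?_⟩
      rw [← refl _ _ _ _ _ rfl e1, ← refl _ _ _ _ _ rfl e2]
      unfold sides
      rw [hG.closer_square h1 h2 h3 h4 h5 h6, hG.closer_square h1.symm h4.symm h3.symm h2.symm h6 h5]
      exact Set.pair_comm _ _
    | refl e => exact ⟨Iff.rfl, fun _ => refl e⟩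
    | symm e f _ ih =>
      exact ⟨ih.1.symm, fun hf a b c d e1 e2 => (ih.2 (ih.1.2 hf) c d a b e2 e1).symm⟩
    | trans e f k _ _ ih1 ih2 =>
      refine ⟨ih1.1.trans ih2.1, fun he a b c d e1 e2 => ?_⟩
      have hf := ih1.1.1 he
      induction f with | _ p q =>
      exact (ih1.2 he a b p q e1 rfl).trans (ih2.2 hf p q c d rfl e2)
  exact ⟨aux.1.1 he, aux.2 he⟩

/-- A hyperplane is the edge boundary of either of its halfspaces. This replaces the generated
equivalence relation by a metric condition. -/
theorem IsMedian.mem_edgeClass (hG : IsMedian G) {a b : V} (hab : G.Adj a b) {u v : V} :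
    s(u, v) ∈ edgeClass G s(a, b) ↔
      G.Adj u v ∧ ¬ (u ∈ closer G a b ↔ v ∈ closer G a b) := by
  have hc := hG.compl_closer hab
  constructor
  · intro h
    obtain ⟨h1, h2⟩ := hG.sides_eq_of_eqvGen h hab
    have huv : G.Adj u v := h1
    refine ⟨huv, ?_⟩
    have h3 := h2 a b u v rfl rfl
    have h4 : closer G a b ∈ sides G u v := h3 ▸ Set.mem_insert _ _
    have h5 := left_mem_closer huv
    have h6 := left_mem_closer huv.symm
    have h7 := hG.compl_closer huv
    rcases h4 with h4 | h4
    · rw [h4]; rw [← h7] at h6; exact fun h => h6 (h.1 h5)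
    · rw [Set.mem_singleton_iff] at h4
      rw [h4]; rw [← h7] at h6 ⊢; exact fun h => h.2 h6 h5
  · rintro ⟨huv, h⟩
    by_cases hu : u ∈ closer G a b
    · refine hG.eqvGen_of_crossing hab huv hu ?_
      rw [← hc]; exact fun hv => h ⟨fun _ => hv, fun _ => hu⟩
    · have hv : v ∈ closer G a b := by by_contra hv; exact h ⟨fun h => (hu h).elim, fun h => (hv h).elim⟩
      rw [Sym2.eq_swap (a := u)]
      refine hG.eqvGen_of_crossing hab huv.symm hv ?_
      rw [← hc]; exact hu

theorem IsMedian.closer_eq_of_crossing (hG : IsMedian G) {a b u v : V} (hab : G.Adj a b)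
    (huv : G.Adj u v) (hu : u ∈ closer G a b) (hv : v ∉ closer G a b) :
    closer G u v = closer G a b := by
  have h := hG.eqvGen_of_crossing hab huv hu (by rw [← hG.compl_closer hab]; exact hv)
  have h2 := (hG.sides_eq_of_eqvGen h hab).2 a b u v rfl rfl
  have h3 : closer G a b ∈ sides G u v := h2 ▸ Set.mem_insert _ _
  rcases h3 with h3 | h3
  · exact h3.symm
  · rw [Set.mem_singleton_iff] at h3
    rw [h3, ← hG.compl_closer huv] at hu
    exact (hu (left_mem_closer huv)).elim

/-- If a geodesic from `u` towards `w` left the set along an edge `uu'`, that edge would cut out the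
same halfspace, so `v` would be nearer to `u` than to `u'`; but `u'` is one step nearer to `v`. -/
theorem IsMedian.closer_convex (hG : IsMedian G) {a b : V} (hab : G.Adj a b) {u v w : V}
    (hu : u ∈ closer G a b) (hv : v ∈ closer G a b) (hw : w ∈ interval G u v) :
    w ∈ closer G a b := by
  by_contra hwn
  have cm : ∀ u v, G.dist u v = G.dist v u := fun _ _ => SimpleGraph.dist_comm
  suffices h : ∀ k u, G.dist u w = k → u ∈ closer G a b → w ∈ interval G u v → False from
    h _ u rfl hu hw
  intro k
  induction k with
  | zero =>
    intro u hk hu _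
    rw [hG.connected.dist_eq_zero_iff] at hk
    exact hwn (hk ▸ hu)
  | succ k ih =>
    intro u hk hu hw
    obtain ⟨u', huu', hd⟩ := exists_adj_dist_eq hG.connected hk
    have hw' : G.dist u w + G.dist w v = G.dist u v := hw
    have t := hG.connected.dist_triangle (u := u') (v := w) (w := v)
    have e := hG.dist_adj huu' v
    rw [cm v u, cm v u'] at e
    by_cases hu' : u' ∈ closer G a b
    · refine ih u' hd hu' ?_
      change G.dist u' w + G.dist w v = G.dist u' v
      omega
    · rw [← hG.closer_eq_of_crossing hab huu' hu hu', hG.mem_closer huu', cm v u, cm v u'] at hv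
      omega

/-! ### Halfspaces of median graphs -/

theorem IsMedian.reachable_of_mem_closer (hG : IsMedian G) {a b : V} (hab : G.Adj a b) {v : V}
    (hv : v ∈ closer G a b) : (G.deleteEdges (edgeClass G s(a, b))).Reachable v a := by
  suffices h : ∀ k v, G.dist v a = k → v ∈ closer G a b →
      (G.deleteEdges (edgeClass G s(a, b))).Reachable v a from h _ v rfl hv
  intro k
  induction k with
  | zero =>
    intro v hk hv
    rw [hG.connected.dist_eq_zero_iff] at hk
    rw [hk]
  | succ k ih =>
    intro v hk hv
    obtain ⟨v', hvv', hd⟩ := exists_adj_dist_eq hG.connected hk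
    have hv' : v' ∈ closer G a b := by
      rw [hG.mem_closer hab] at hv ⊢
      have e := hG.dist_adj hab v'
      have t := hG.connected.dist_triangle (u := v) (v := v') (w := b)
      rw [SimpleGraph.dist_eq_one_iff_adj.2 hvv'] at t
      omega
    refine .trans (SimpleGraph.Adj.reachable ?_) (ih v' hd hv')
    rw [SimpleGraph.deleteEdges_adj, hG.mem_edgeClass hab]
    exact ⟨hvv', fun h => h.2 ⟨fun _ => hv', fun _ => hv⟩⟩

theorem IsMedian.mem_closer_iff_of_reachable (hG : IsMedian G) {a b : V} (hab : G.Adj a b)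
    {u v : V} (h : (G.deleteEdges (edgeClass G s(a, b))).Reachable u v) :
    u ∈ closer G a b ↔ v ∈ closer G a b := by
  obtain ⟨p⟩ := h
  induction p with
  | nil => rfl
  | cons h _ ih =>
    refine Iff.trans ?_ ih
    rw [SimpleGraph.deleteEdges_adj, hG.mem_edgeClass hab] at h
    by_contra hc
    exact h.2 ⟨h.1, hc⟩

/-- The side of the hyperplane `J` containing the vertex `x`. -/
def Hyperplane.sideOf (J : Hyperplane G) (x : V) : Set V := (principal G x).side J

theorem Hyperplane.mem_sideOf (J : Hyperplane G) (x : V) : x ∈ J.sideOf x := rfl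

theorem Hyperplane.sideOf_mem (J : Hyperplane G) (x : V) : J.sideOf x ∈ J.halfspaces := ⟨_, rfl⟩

theorem Hyperplane.sideOf_eq_of_mem {J : Hyperplane G} {D : Set V} (hD : D ∈ J.halfspaces) {x : V}
    (hx : x ∈ D) : J.sideOf x = D := by
  obtain ⟨c, rfl⟩ := hD
  have hx : (G.deleteEdges J.1).connectedComponentMk x = c := hx
  simp [sideOf, principal, hx]

/-- The hyperplane crossing an edge. -/
def hyperplaneOf {a b : V} (hab : G.Adj a b) : Hyperplane G :=
  ⟨edgeClass G s(a, b), s(a, b), hab, rfl⟩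

theorem IsMedian.sideOf_hyperplaneOf (hG : IsMedian G) {a b : V} (hab : G.Adj a b) (x : V) :
    x ∈ closer G a b ↔ (hyperplaneOf hab).sideOf x = closer G a b := by
  refine ⟨fun hx => ?_, fun hx => hx ▸ Hyperplane.mem_sideOf _ x⟩
  ext y
  change (G.deleteEdges _).connectedComponentMk y = _ ↔ _
  rw [SimpleGraph.ConnectedComponent.eq]
  refine ⟨fun h => (hG.mem_closer_iff_of_reachable hab h).2 hx, fun hy => ?_⟩
  exact (hG.reachable_of_mem_closer hab hy).trans (hG.reachable_of_mem_closer hab hx).symm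

theorem hyperplaneOf_symm {a b : V} (hab : G.Adj a b) : hyperplaneOf hab.symm = hyperplaneOf hab :=
  Subtype.ext (by simp [hyperplaneOf, Sym2.eq_swap])

theorem IsMedian.halfspaces_hyperplaneOf (hG : IsMedian G) {a b : V} (hab : G.Adj a b) :
    (hyperplaneOf hab).halfspaces = {closer G a b, closer G b a} := by
  ext D
  constructor
  · rintro hD
    have hne : D.Nonempty := by
      obtain ⟨c, rfl⟩ := hD
      exact c.nonempty_supp
    obtain ⟨x, hx⟩ := hne
    rw [← Hyperplane.sideOf_eq_of_mem hD hx]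
    by_cases h : x ∈ closer G a b
    · exact Or.inl ((hG.sideOf_hyperplaneOf hab x).1 h)
    · right
      rw [← hyperplaneOf_symm]
      refine (hG.sideOf_hyperplaneOf hab.symm x).1 ?_
      rw [← hG.compl_closer hab]; exact h
  · rintro (rfl | rfl)
    · rw [← (hG.sideOf_hyperplaneOf hab a).1 (left_mem_closer hab)]
      exact Hyperplane.sideOf_mem _ _
    · rw [← hyperplaneOf_symm, ← (hG.sideOf_hyperplaneOf hab.symm b).1 (left_mem_closer hab.symm)]
      exact Hyperplane.sideOf_mem _ _

theorem Hyperplane.exists_adj (J : Hyperplane G) :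
    ∃ (a b : V) (hab : G.Adj a b), J = hyperplaneOf hab := by
  obtain ⟨e, he, hJ⟩ := J.2
  induction e with | _ a b => exact ⟨a, b, he, Subtype.ext hJ⟩

theorem IsMedian.exists_closer (hG : IsMedian G) {J : Hyperplane G} {D : Set V}
    (hD : D ∈ J.halfspaces) :
    ∃ (a b : V) (hab : G.Adj a b), J = hyperplaneOf hab ∧ D = closer G a b := by
  obtain ⟨a, b, hab, rfl⟩ := J.exists_adj
  rw [hG.halfspaces_hyperplaneOf hab] at hD
  rcases hD with rfl | rfl
  · exact ⟨a, b, hab, rfl, rfl⟩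
  · exact ⟨b, a, hab.symm, (hyperplaneOf_symm hab).symm, rfl⟩

theorem IsMedian.halfspaces_eq (hG : IsMedian G) {J : Hyperplane G} {D : Set V}
    (hD : D ∈ J.halfspaces) : J.halfspaces = {D, Dᶜ} := by
  obtain ⟨a, b, hab, rfl, rfl⟩ := hG.exists_closer hD
  rw [hG.halfspaces_hyperplaneOf hab, hG.compl_closer hab]

theorem IsMedian.halfspace_convex (hG : IsMedian G) {D : Set V} (hD : IsHalfspace G D)
    {u v w : V} (hu : u ∈ D) (hv : v ∈ D) (hw : w ∈ interval G u v) : w ∈ D := by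
  obtain ⟨J, hJ⟩ := hD
  obtain ⟨a, b, hab, rfl, rfl⟩ := hG.exists_closer hJ
  exact hG.closer_convex hab hu hv hw

/-- The hyperplane is recovered from the halfspace as its edge boundary. -/
theorem IsMedian.hyperplane_unique (hG : IsMedian G) {J K : Hyperplane G} {D : Set V}
    (hJ : D ∈ J.halfspaces) (hK : D ∈ K.halfspaces) : J = K := by
  obtain ⟨a, b, hab, rfl, rfl⟩ := hG.exists_closer hJ
  obtain ⟨c, d, hcd, rfl, h⟩ := hG.exists_closer hK
  refine Subtype.ext (Set.ext fun e => ?_)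
  induction e with | _ u v =>
  change s(u, v) ∈ edgeClass G _ ↔ s(u, v) ∈ edgeClass G _
  rw [hG.mem_edgeClass hab, hG.mem_edgeClass hcd, h]

theorem nonempty_of_mem_halfspaces {J : Hyperplane G} {D : Set V} (hD : D ∈ J.halfspaces) :
    D.Nonempty := by
  obtain ⟨c, rfl⟩ := hD
  exact c.nonempty_supp

theorem IsMedian.eq_or_eq_compl (hG : IsMedian G) {J : Hyperplane G} {D E : Set V}
    (hD : D ∈ J.halfspaces) (hE : E ∈ J.halfspaces) : E = D ∨ E = Dᶜ := by
  rw [hG.halfspaces_eq hD] at hE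
  exact hE

theorem IsMedian.compl_mem_halfspaces (hG : IsMedian G) {J : Hyperplane G} {D : Set V}
    (hD : D ∈ J.halfspaces) : Dᶜ ∈ J.halfspaces := by
  rw [hG.halfspaces_eq hD]
  exact Or.inr rfl

/-! ### Distances and separating hyperplanes -/

/-- The hyperplanes on which two orientations differ. -/
def sep (σ τ : Orientation G) : Set (Hyperplane G) := {J | σ.side J ≠ τ.side J}

theorem sep_comm (σ τ : Orientation G) : sep σ τ = sep τ σ := by
  ext J; exact ne_comm

theorem sep_subset_union (σ τ ρ : Orientation G) : sep σ ρ ⊆ sep σ τ ∪ sep τ ρ := by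
  intro J hJ
  by_contra h
  simp only [sep, Set.mem_union, Set.mem_ofPred_eq, not_or, not_not] at h
  exact hJ (h.1.trans h.2)

theorem eq_of_sep_eq_empty {σ τ : Orientation G} (h : sep σ τ = ∅) : σ = τ := by
  refine Orientation.ext (funext fun J => ?_)
  by_contra hJ
  exact (h ▸ (hJ : J ∈ sep σ τ) : J ∈ (∅ : Set (Hyperplane G)))

theorem mem_sep_principal {x y : V} {J : Hyperplane G} :
    J ∈ sep (principal G x) (principal G y) ↔ y ∉ J.sideOf x := by
  refine not_congr ⟨fun h => ?_, fun h => ?_⟩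
  · change y ∈ (principal G x).side J
    rw [h]; exact Hyperplane.mem_sideOf J y
  · exact (Hyperplane.sideOf_eq_of_mem (J.sideOf_mem x) h).symm

theorem sep_principal_finite (hG : G.Connected) (x y : V) :
    (sep (principal G x) (principal G y)).Finite := by
  refine (finite_not_reachable hG x y).subset fun J hJ hr => hJ ?_
  simp only [principal, SimpleGraph.ConnectedComponent.eq.2 hr]

theorem IsMedian.sep_principal_of_adj (hG : IsMedian G) {a b : V} (hab : G.Adj a b) :
    sep (principal G a) (principal G b) = {hyperplaneOf hab} := by
  ext J
  rw [mem_sep_principal, Set.mem_singleton_iff]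
  obtain ⟨c, d, hcd, rfl, h⟩ := hG.exists_closer (J.sideOf_mem a)
  have ha : a ∈ closer G c d := h ▸ Hyperplane.mem_sideOf _ a
  rw [h]
  constructor
  · intro hb
    refine Subtype.ext (Set.ext fun e => ?_)
    induction e with | _ u v =>
    change s(u, v) ∈ edgeClass G _ ↔ s(u, v) ∈ edgeClass G _
    rw [hG.mem_edgeClass hab, hG.mem_edgeClass hcd, hG.closer_eq_of_crossing hcd hab ha hb]
  · intro he hb
    have : s(a, b) ∈ edgeClass G s(c, d) := by
      have := congrArg Subtype.val he
      change edgeClass G _ = edgeClass G _ at this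
      rw [this]
      exact .refl _
    rw [hG.mem_edgeClass hcd] at this
    exact this.2 ⟨fun _ => hb, fun _ => ha⟩

/-- Geodesics cross each hyperplane at most once: after the first edge `xx'`, the target `y` lies on
the side of `x'`. -/
theorem IsMedian.ncard_sep_principal (hG : IsMedian G) (x y : V) :
    (sep (principal G x) (principal G y)).ncard = G.dist x y := by
  suffices h : ∀ k x, G.dist x y = k → (sep (principal G x) (principal G y)).ncard = k from
    h _ x rfl
  intro k
  induction k with
  | zero =>
    intro x hk
    rw [hG.connected.dist_eq_zero_iff] at hk
    subst hk
    simp [sep]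
  | succ k ih =>
    intro x hk
    obtain ⟨x', hx, hd⟩ := exists_adj_dist_eq hG.connected hk
    have h1 := hG.sep_principal_of_adj hx
    have hy : y ∈ closer G x' x := by
      rw [closer, Set.mem_ofPred_eq, SimpleGraph.dist_comm, hd, SimpleGraph.dist_comm, hk]
      omega
    have h2 : hyperplaneOf hx ∉ sep (principal G x') (principal G y) := by
      rw [mem_sep_principal, not_not, ← hyperplaneOf_symm,
        (hG.sideOf_hyperplaneOf hx.symm x').1 (left_mem_closer hx.symm)]
      exact hy
    have h3 : sep (principal G x) (principal G y) =
        insert (hyperplaneOf hx) (sep (principal G x') (principal G y)) := by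
      ext J
      by_cases hJ : J = hyperplaneOf hx
      · subst hJ
        simp only [Set.mem_insert_iff, true_or, iff_true]
        intro h
        have : hyperplaneOf hx ∈ sep (principal G x) (principal G x') := by simp [h1]
        rw [sep, Set.mem_ofPred_eq, h] at this
        exact h2 this.symm
      · have : J ∉ sep (principal G x) (principal G x') := by simpa [h1] using hJ
        simp only [sep, Set.mem_ofPred_eq, not_not] at this
        simp [sep, hJ, this]
    rw [h3, Set.ncard_insert_of_notMem h2 (sep_principal_finite hG.connected _ _), ih x' hd]

theorem IsMedian.adj_iff_existsUnique (hG : IsMedian G) {x y : V} :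
    G.Adj x y ↔ ∃! J : Hyperplane G, (principal G x).side J ≠ (principal G y).side J := by
  rw [← SimpleGraph.dist_eq_one_iff_adj, ← hG.ncard_sep_principal, Set.ncard_eq_one]
  simp only [sep, Set.ext_iff, ExistsUnique, Set.mem_ofPred_eq, Set.mem_singleton_iff]
  refine exists_congr fun J => ⟨fun h => ⟨(h J).2 rfl, fun K => (h K).1⟩, fun h K =>
    ⟨h.2 K, fun e => e ▸ h.1⟩⟩

/-- The nearest vertex of a halfspace lies between the given vertex and any vertex of the
halfspace. -/
theorem IsMedian.exists_gate (hG : IsMedian G) {D : Set V} (hD : IsHalfspace G D) (v : V) :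
    ∃ w ∈ D, ∀ p ∈ D, w ∈ interval G v p := by
  obtain ⟨J, hJ⟩ := hD
  obtain ⟨w, hw, hmin⟩ := exists_minimalFor_of_wellFoundedLT (· ∈ D) (G.dist v)
    (nonempty_of_mem_halfspaces hJ)
  refine ⟨w, hw, fun p hp => ?_⟩
  -- By convexity this median is in `D`; as it lies between `v` and the nearest vertex `w`, it
  -- equals `w`.
  obtain ⟨m, ⟨h1, h2, h3⟩, -⟩ := hG.existsUnique_median v w p
  have hm : m ∈ D := hG.halfspace_convex ⟨J, hJ⟩ hw hp h2
  have h4 : G.dist v m + G.dist m w = G.dist v w := h1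
  have h5 : G.dist v w ≤ G.dist v m := by
    by_contra h
    have := hmin hm (by omega)
    omega
  have h6 : G.dist m w = 0 := by omega
  rw [hG.connected.dist_eq_zero_iff] at h6
  exact h6 ▸ h3

/-- An orientation that differs from a principal one on finitely many hyperplanes is principal. -/
theorem IsMedian.exists_principal (hG : IsMedian G) {σ : Orientation G} {x : V}
    (h : (sep σ (principal G x)).Finite) : ∃ v, σ = principal G v := by
  suffices H : ∀ k x, (sep σ (principal G x)).Finite → (sep σ (principal G x)).ncard = k →
      ∃ v, σ = principal G v from H _ x h rfl
  intro k
  induction k with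
  | zero =>
    intro x hf hk
    exact ⟨x, eq_of_sep_eq_empty ((Set.ncard_eq_zero hf).1 hk)⟩
  | succ k ih =>
    intro x hf hk
    obtain ⟨J, hJ⟩ : (sep σ (principal G x)).Nonempty := by
      rw [← Set.ncard_pos hf]; omega
    have hxD : x ∉ σ.side J := fun hx =>
      hJ (Hyperplane.sideOf_eq_of_mem (σ.side_mem J) hx).symm
    obtain ⟨w, hw, hgate⟩ := hG.exists_gate ⟨J, σ.side_mem J⟩ x
    have hd : G.dist x w ≠ 0 := by
      rw [Ne, hG.connected.dist_eq_zero_iff]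
      rintro rfl
      exact hxD hw
    obtain ⟨d, hd⟩ := Nat.exists_eq_succ_of_ne_zero hd
    obtain ⟨x', hx', hd'⟩ := exists_adj_dist_eq hG.connected hd
    -- `x'` is the first vertex on a geodesic from `x` to the gate `w`. Since `σ.side J` lies beyond
    -- the edge `xx'`, `σ` must choose the side of `x'`, and replacing `x` by `x'` removes exactly
    -- one hyperplane from the difference.
    have hsub : σ.side J ⊆ closer G x' x := by
      intro p hp
      rw [← hG.compl_closer hx']
      intro hp'
      have := hG.closer_convex hx' (left_mem_closer hx') hp' (hgate p hp)
      rw [hG.mem_closer hx', SimpleGraph.dist_comm, hd', SimpleGraph.dist_comm, hd] at this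
      omega
    have hK : σ.side (hyperplaneOf hx') = closer G x' x := by
      have h1 := σ.side_mem (hyperplaneOf hx')
      rw [hG.halfspaces_hyperplaneOf hx'] at h1
      rcases h1 with h1 | h1
      · obtain ⟨p, hp1, hp2⟩ := σ.inter_nonempty J (hyperplaneOf hx')
        rw [h1] at hp2
        have := hsub hp1
        rw [← hG.compl_closer hx'] at this
        exact (this hp2).elim
      · exact h1
    have hx'K : (principal G x').side (hyperplaneOf hx') = closer G x' x := by
      rw [← hyperplaneOf_symm]
      exact (hG.sideOf_hyperplaneOf hx'.symm x').1 (left_mem_closer hx'.symm)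
    have hxK : (principal G x).side (hyperplaneOf hx') = closer G x x' :=
      (hG.sideOf_hyperplaneOf hx' x).1 (left_mem_closer hx')
    have hmem : hyperplaneOf hx' ∈ sep σ (principal G x) := by
      intro he
      rw [hK, hxK, ← hG.compl_closer hx'] at he
      have := left_mem_closer hx'
      rw [← he] at this
      exact this (left_mem_closer hx')
    have heq : sep σ (principal G x') = sep σ (principal G x) \ {hyperplaneOf hx'} := by
      ext L
      by_cases hL : L = hyperplaneOf hx'
      · subst hL
        simp [sep, hK, hx'K]
      · have : L ∉ sep (principal G x) (principal G x') := by
          simpa [hG.sep_principal_of_adj hx'] using hL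
        simp only [sep, Set.mem_ofPred_eq, not_not] at this
        simp [sep, hL, this]
    refine ih x' (heq ▸ hf.sdiff) ?_
    rw [heq, Set.ncard_sdiff_singleton_of_mem hmem, hk]
    rfl

/-! ### The Roller graph -/

/-- The orientation obtained by flipping one hyperplane. -/
noncomputable def flip (σ τ : Orientation G) (J : Hyperplane G)
    (h : ∀ K, K ≠ J → (τ.side J ∩ σ.side K).Nonempty) : Orientation G := by
  classical
  exact
  { side := Function.update σ.side J (τ.side J)
    side_mem := fun K => by
      by_cases hK : K = J
      · subst hK; simpa using τ.side_mem K
      · simpa [hK] using σ.side_mem K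
    inter_nonempty := fun K L => by
      by_cases hK : K = J
      · by_cases hL : L = J
        · subst hK; subst hL
          simpa using τ.inter_nonempty L L
        · subst hK
          simpa [hL] using h L hL
      · by_cases hL : L = J
        · subst hL
          simpa [hK, Set.inter_comm] using h K hK
        · simpa [hK, hL] using σ.inter_nonempty K L }

theorem flip_side_self {σ τ : Orientation G} {J : Hyperplane G}
    (h : ∀ K, K ≠ J → (τ.side J ∩ σ.side K).Nonempty) : (flip σ τ J h).side J = τ.side J := by
  simp [flip]

theorem flip_side_of_ne {σ τ : Orientation G} {J : Hyperplane G}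
    (h : ∀ K, K ≠ J → (τ.side J ∩ σ.side K).Nonempty) {K : Hyperplane G} (hK : K ≠ J) :
    (flip σ τ J h).side K = σ.side K := by
  simp [flip, hK]

theorem IsMedian.side_eq_compl (hG : IsMedian G) {σ τ : Orientation G} {J : Hyperplane G}
    (h : σ.side J ≠ τ.side J) : σ.side J = (τ.side J)ᶜ :=
  (hG.eq_or_eq_compl (τ.side_mem J) (σ.side_mem J)).resolve_left h

theorem IsMedian.exists_walk_length_le (hG : IsMedian G) (σ τ : Orientation G)
    (h : (sep σ τ).Finite) : ∃ p : (rollerGraph G).Walk σ τ, p.length ≤ (sep σ τ).ncard := by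
  suffices H : ∀ k σ, (sep σ τ).Finite → (sep σ τ).ncard = k →
      ∃ p : (rollerGraph G).Walk σ τ, p.length ≤ k from H _ σ h rfl
  intro k
  induction k with
  | zero =>
    intro σ hf hk
    obtain rfl := eq_of_sep_eq_empty ((Set.ncard_eq_zero hf).1 hk)
    exact ⟨.nil, le_rfl⟩
  | succ k ih =>
    intro σ hf hk
    have hne : (sep σ τ).Nonempty := by
      rw [← Set.ncard_pos hf]; omega
    -- Maximality makes the flip at `J` legitimate: if `τ.side J` missed `σ.side K`, the complement
    -- of `τ.side K`, it would be strictly inside `τ.side K`.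
    obtain ⟨J, hJ, hmax⟩ := hf.exists_maximalFor τ.side _ hne
    have hflip : ∀ K, K ≠ J → (τ.side J ∩ σ.side K).Nonempty := by
      intro K hKJ
      by_cases hK : σ.side K = τ.side K
      · rw [hK]; exact τ.inter_nonempty J K
      · rw [hG.side_eq_compl hK]
        by_contra hem
        have hle : τ.side J ⊆ τ.side K := fun p hp => by
          by_contra hpK
          exact hem ⟨p, hp, hpK⟩
        have := hle.antisymm (hmax (show K ∈ sep σ τ from hK) hle)
        exact hKJ (hG.hyperplane_unique (τ.side_mem K) (this ▸ τ.side_mem J))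
    have hadj : (rollerGraph G).Adj σ (flip σ τ J hflip) := by
      refine ⟨J, ?_, fun K hK => ?_⟩
      · simp only [flip_side_self]; exact hJ
      · by_contra hKJ
        exact hK (flip_side_of_ne hflip hKJ).symm
    have heq : sep (flip σ τ J hflip) τ = sep σ τ \ {J} := by
      ext K
      by_cases hK : K = J
      · subst hK; simp [sep, flip_side_self]
      · simp [sep, flip_side_of_ne hflip hK, hK]
    obtain ⟨p, hp⟩ := ih (flip σ τ J hflip) (heq ▸ hf.sdiff)
      (by rw [heq, Set.ncard_sdiff_singleton_of_mem hJ, hk]; rfl)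
    exact ⟨.cons hadj p, by simpa using hp⟩

theorem sep_finite_ncard_le_length {σ τ : Orientation G} (p : (rollerGraph G).Walk σ τ) :
    (sep σ τ).Finite ∧ (sep σ τ).ncard ≤ p.length := by
  induction p with
  | nil => simp [sep]
  | @cons u v w h p ih =>
    obtain ⟨J, hJ, hu⟩ := id h
    have h1 : sep u v ⊆ {J} := fun K hK => hu K hK
    have h2 := (sep_subset_union u v w).trans (Set.union_subset_union_left _ h1)
    have hf : ({J} ∪ sep v w).Finite := (Set.finite_singleton J).union ih.1
    refine ⟨hf.subset h2, (Set.ncard_le_ncard h2 hf).trans ?_⟩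
    refine (Set.ncard_union_le _ _).trans ?_
    rw [Set.ncard_singleton, SimpleGraph.Walk.length_cons]
    omega

theorem IsMedian.mem_supp_iff (hG : IsMedian G) {Y : Component G} {σ τ : Orientation G}
    (hσ : σ ∈ Y.supp) : τ ∈ Y.supp ↔ (sep σ τ).Finite := by
  rw [SimpleGraph.ConnectedComponent.mem_supp_iff] at hσ ⊢
  rw [← hσ, SimpleGraph.ConnectedComponent.eq]
  constructor
  · rintro ⟨p⟩
    rw [sep_comm]
    exact (sep_finite_ncard_le_length p).1
  · intro h
    rw [sep_comm] at h
    exact ⟨(hG.exists_walk_length_le τ σ h).choose⟩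

theorem IsMedian.roller_dist (hG : IsMedian G) {σ τ : Orientation G}
    (h : (sep σ τ).Finite) : (rollerGraph G).dist σ τ = (sep σ τ).ncard := by
  obtain ⟨p, hp⟩ := hG.exists_walk_length_le σ τ h
  refine le_antisymm ((SimpleGraph.dist_le p).trans hp) ?_
  obtain ⟨q, hq⟩ := SimpleGraph.Reachable.exists_walk_length_eq_dist ⟨p⟩
  rw [← hq]
  exact (sep_finite_ncard_le_length q).2

end Geometry

/-! ### Transfers of commensurate sets -/

section Transfer

variable {α : Type*}

/-- Two sets that differ by finitely many elements. -/
def Commensurate (A B : Set α) : Prop := (A \ B).Finite ∧ (B \ A).Finite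

theorem Commensurate.symm {A B : Set α} (h : Commensurate A B) : Commensurate B A := ⟨h.2, h.1⟩

theorem Commensurate.trans {A B C : Set α} (h : Commensurate A B) (h' : Commensurate B C) :
    Commensurate A C :=
  ⟨(h.1.union h'.1).subset fun a ha => by
      by_cases hB : a ∈ B
      exacts [Or.inr ⟨hB, ha.2⟩, Or.inl ⟨ha.1, hB⟩],
    (h.2.union h'.2).subset fun a ha => by
      by_cases hB : a ∈ B
      exacts [Or.inl ⟨hB, ha.2⟩, Or.inr ⟨ha.1, hB⟩]⟩

theorem Commensurate.sdiff {A B C D : Set α} (h : Commensurate A B) (h' : Commensurate C D) :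
    Commensurate (A \ C) (B \ D) :=
  ⟨(h.1.union h'.2).subset fun a ha => by
      by_cases hB : a ∈ B
      · exact Or.inr ⟨by_contra fun hD => ha.2 ⟨hB, hD⟩, ha.1.2⟩
      · exact Or.inl ⟨ha.1.1, hB⟩,
    (h.2.union h'.1).subset fun a ha => by
      by_cases hA : a ∈ A
      · exact Or.inr ⟨by_contra fun hC => ha.2 ⟨hA, hC⟩, ha.1.2⟩
      · exact Or.inl ⟨ha.1.1, hA⟩⟩

theorem commensurate_of_finite {A B : Set α} (hA : A.Finite) (hB : B.Finite) :
    Commensurate A B := ⟨hA.sdiff, hB.sdiff⟩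

theorem Commensurate.smul {Γ : Type*} [Group Γ] [MulAction Γ α] (g : Γ) {A B : Set α}
    (h : Commensurate A B) : Commensurate (g • A) (g • B) := by
  unfold Commensurate
  rw [← Set.smul_set_sdiff, ← Set.smul_set_sdiff]
  exact ⟨h.1.smul_set, h.2.smul_set⟩

theorem finsum_indicator_one {A : Set α} (hA : A.Finite) :
    ∑ᶠ a, A.indicator (1 : α → ℤ) a = A.ncard := by
  lift A to Finset α using hA
  rw [← finsum_mem_def, finsum_mem_coe_finset]
  simp

theorem indicator_sub_indicator (A B : Set α) (a : α) :
    A.indicator (1 : α → ℤ) a - B.indicator (1 : α → ℤ) a =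
      (A \ B).indicator (1 : α → ℤ) a - (B \ A).indicator (1 : α → ℤ) a := by
  by_cases hA : a ∈ A <;> by_cases hB : a ∈ B <;> simp [hA, hB]

theorem hasFiniteSupport_indicator {A : Set α} (hA : A.Finite) :
    Function.HasFiniteSupport (A.indicator (1 : α → ℤ)) :=
  hA.subset fun a ha => by by_contra h; simp [h] at ha

/-- As a finite sum of differences of indicators, the transfer becomes visibly additive, even when
both sets are infinite. -/
theorem transfer_eq_finsum {A B : Set α} (h : Commensurate A B) :
    transfer A B = ∑ᶠ a, (A.indicator (1 : α → ℤ) a - B.indicator (1 : α → ℤ) a) := by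
  simp only [indicator_sub_indicator A B]
  rw [finsum_sub_distrib (hasFiniteSupport_indicator h.1) (hasFiniteSupport_indicator h.2),
    finsum_indicator_one h.1, finsum_indicator_one h.2, transfer]

theorem Commensurate.hasFiniteSupport {A B : Set α} (h : Commensurate A B) :
    Function.HasFiniteSupport
      fun a => A.indicator (1 : α → ℤ) a - B.indicator (1 : α → ℤ) a :=
  (h.1.union h.2).subset fun a ha => by
    by_contra hc
    simp only [Set.mem_union, Set.mem_sdiff, not_or, not_and, not_not] at hc
    by_cases hA : a ∈ A
    · simp [hA, hc.1 hA] at ha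
    · exact hA (hc.2 (by simpa [hA] using ha))

theorem transfer_sdiff {A B C D : Set α} (hCA : C ⊆ A) (hDB : D ⊆ B) (h : Commensurate A B)
    (h' : Commensurate C D) : transfer (A \ C) (B \ D) = transfer A B - transfer C D := by
  rw [transfer_eq_finsum (h.sdiff h'), transfer_eq_finsum h, transfer_eq_finsum h',
    ← finsum_sub_distrib h.hasFiniteSupport h'.hasFiniteSupport]
  refine finsum_congr fun a => ?_
  rw [Set.indicator_sdiff hCA, Set.indicator_sdiff hDB]
  simp only [Pi.sub_apply]
  ring

theorem transfer_of_finite {A B : Set α} (hA : A.Finite) (hB : B.Finite) :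
    transfer A B = A.ncard - B.ncard := by
  rw [transfer_eq_finsum (commensurate_of_finite hA hB),
    finsum_sub_distrib (hasFiniteSupport_indicator hA) (hasFiniteSupport_indicator hB),
    finsum_indicator_one hA, finsum_indicator_one hB]

theorem transfer_image {β : Type*} {f : α → β} (hf : Function.Injective f) (A B : Set α) :
    transfer (f '' A) (f '' B) = transfer A B := by
  unfold transfer
  rw [← Set.image_sdiff hf, ← Set.image_sdiff hf, Set.ncard_image_of_injective _ hf,
    Set.ncard_image_of_injective _ hf]

/-- Removing finitely many elements does not change whether a set is transfer-invariant. -/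
theorem transfer_sdiff_smul {Γ : Type*} [Group Γ] [MulAction Γ α] (g : Γ) {A C : Set α}
    (hCA : C ⊆ A) (hC : C.Finite) (h : Commensurate A (g • A)) :
    transfer (A \ C) (g • (A \ C)) = transfer A (g • A) := by
  rw [Set.smul_set_sdiff, transfer_sdiff hCA (Set.smul_set_mono hCA) h
    (commensurate_of_finite hC hC.smul_set), transfer_of_finite hC hC.smul_set,
    Set.ncard_smul_set, sub_self, sub_zero]

end Transfer

/-! ### Posets of finite width -/

section Width

variable {α : Type*} [PartialOrder α]

/-- `I` is a subset of `P` closed upwards in `P`. -/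
def RelUpper (P I : Set α) : Prop := I ⊆ P ∧ ∀ D ∈ I, ∀ E ∈ P, D ≤ E → E ∈ I

/-- One element is picked in each layer, off the finitely many elements above the previous picks. It
is not below a previous pick either, since that pick has already left the upper set `f k`. -/
theorem exists_antichain_of_chain {P : Set α} (hfin : ∀ D ∈ P, {E ∈ P | D ≤ E}.Finite)
    (f : ℕ → Set α) (hf : ∀ j, RelUpper P (f j)) (k : ℕ)
    (hstep : ∀ j < k, (f j \ f (j + 1)).Infinite) (hmono : ∀ j < k, f (j + 1) ⊆ f j) :
    ∃ T : Finset α, ↑T ⊆ P ∧ IsAntichain (· ≤ ·) (T : Set α) ∧ T.card = k ∧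
      ∀ t ∈ T, t ∉ f k := by
  classical
  induction k with
  | zero => exact ⟨∅, by simp⟩
  | succ k ih =>
    obtain ⟨T, hTP, hTa, hTc, hTf⟩ := ih (fun j hj => hstep j (by omega))
      (fun j hj => hmono j (by omega))
    have hbad : (⋃ s ∈ T, {E ∈ P | s ≤ E}).Finite :=
      T.finite_toSet.biUnion fun s hs => hfin s (hTP hs)
    obtain ⟨t, ht, htb⟩ := ((hstep k (by omega)).sdiff hbad).nonempty
    have htP : t ∈ P := (hf k).1 ht.1
    have hst : ∀ s ∈ T, ¬ s ≤ t := fun s hs hle =>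
      htb (Set.mem_biUnion (show s ∈ (T : Set α) from hs) ⟨htP, hle⟩)
    have hts : ∀ s ∈ T, ¬ t ≤ s := fun s hs hle => hTf s hs ((hf k).2 t ht.1 s (hTP hs) hle)
    have htT : t ∉ T := fun h => hTf t h ht.1
    refine ⟨insert t T, ?_, ?_, by rw [Finset.card_insert_of_notMem htT, hTc], ?_⟩
    · rw [Finset.coe_insert]
      exact Set.insert_subset htP hTP
    · rw [Finset.coe_insert]
      exact hTa.insert (fun s hs _ => hst s hs) (fun s hs _ => hts s hs)
    · intro s hs
      rcases Finset.mem_insert.1 hs with rfl | hs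
      · exact ht.2
      · exact fun h => hTf s hs (hmono k (by omega) h)

/-- Every element is comparable with only finitely many others, so a greedy choice never stops. -/
theorem exists_antichain_of_infinite {S : Set α} (hS : S.Infinite)
    (h1 : ∀ D ∈ S, {E ∈ S | D ≤ E}.Finite) (h2 : ∀ D ∈ S, {E ∈ S | E ≤ D}.Finite) (k : ℕ) :
    ∃ T : Finset α, ↑T ⊆ S ∧ IsAntichain (· ≤ ·) (T : Set α) ∧ T.card = k := by
  classical
  induction k with
  | zero => exact ⟨∅, by simp⟩
  | succ k ih =>
    obtain ⟨T, hTS, hTa, hTc⟩ := ih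
    have hbad : (⋃ s ∈ T, ({E ∈ S | s ≤ E} ∪ {E ∈ S | E ≤ s})).Finite :=
      T.finite_toSet.biUnion fun s hs => (h1 s (hTS hs)).union (h2 s (hTS hs))
    obtain ⟨t, ht, htb⟩ := (hS.sdiff hbad).nonempty
    have hst : ∀ s ∈ T, ¬ s ≤ t := fun s hs hle =>
      htb (Set.mem_biUnion (show s ∈ (T : Set α) from hs) (Or.inl ⟨ht, hle⟩))
    have hts : ∀ s ∈ T, ¬ t ≤ s := fun s hs hle =>
      htb (Set.mem_biUnion (show s ∈ (T : Set α) from hs) (Or.inr ⟨ht, hle⟩))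
    have htT : t ∉ T := fun h => hst t h le_rfl
    refine ⟨insert t T, ?_, ?_, by rw [Finset.card_insert_of_notMem htT, hTc]⟩
    · rw [Finset.coe_insert]
      exact Set.insert_subset ht hTS
    · rw [Finset.coe_insert]
      exact hTa.insert (fun s hs _ => hst s hs) (fun s hs _ => hts s hs)

/-- A subset of a partial order whose principal upper sets are finite and whose antichains have
at most `n` elements. -/
structure NarrowSet (n : ℕ) (P : Set α) : Prop where
  finite_ge : ∀ D ∈ P, {E ∈ P | D ≤ E}.Finite
  card_le : ∀ T : Finset α, ↑T ⊆ P → IsAntichain (· ≤ ·) (T : Set α) → T.card ≤ n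

variable {n : ℕ} {P : Set α}

theorem NarrowSet.mono (hP : NarrowSet n P) {Q : Set α} (h : Q ⊆ P) : NarrowSet n Q :=
  ⟨fun D hD => (hP.finite_ge D (h hD)).subset fun _ hE => ⟨h hE.1, hE.2⟩,
    fun T hT => hP.card_le T (hT.trans h)⟩

theorem NarrowSet.finite_of_finite_le (hP : NarrowSet n P) {S : Set α} (hS : S ⊆ P)
    (h : ∀ D ∈ S, {E ∈ S | E ≤ D}.Finite) : S.Finite := by
  by_contra hinf
  obtain ⟨T, hT, hTa, hTc⟩ := exists_antichain_of_infinite hinf (hP.mono hS).finite_ge h (n + 1)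
  have := hP.card_le T (hT.trans hS) hTa
  omega

/-- Ramsey: an enumeration has a subsequence that strictly decreases, or one with no term strictly
below an earlier one. In the second case the terms form an infinite set with finite lower sets,
against the bound on antichains. -/
theorem NarrowSet.exists_strictAnti (hP : NarrowSet n P) {S : Set α} (hS : S ⊆ P)
    (hinf : S.Infinite) : ∃ f : ℕ → α, StrictAnti f ∧ ∀ i, f i ∈ S := by
  let e := hinf.natEmbedding
  obtain ⟨φ, h | h⟩ := exists_increasing_or_nonincreasing_subseq (· > ·) fun i => (e i : α)
  · exact ⟨fun i => e (φ i), fun i j hij => h i j hij, fun i => (e _).2⟩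
  · exfalso
    have hinj : Function.Injective fun i => (e (φ i) : α) :=
      Subtype.val_injective.comp (e.injective.comp φ.injective)
    have hsub : Set.range (fun i => (e (φ i) : α)) ⊆ P := by
      rintro _ ⟨i, rfl⟩
      exact hS (e _).2
    refine Set.infinite_range_of_injective hinj (hP.finite_of_finite_le hsub ?_)
    rintro _ ⟨i, rfl⟩
    refine ((Set.finite_Iic i).image fun i => (e (φ i) : α)).subset ?_
    rintro _ ⟨⟨j, rfl⟩, hj⟩
    refine ⟨j, ?_, rfl⟩
    by_contra hij
    rw [Set.mem_Iic, not_le] at hij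
    exact h i j hij (lt_of_le_of_ne hj fun he => hij.ne' (hinj he))

theorem RelUpper.empty : RelUpper P ∅ := ⟨Set.empty_subset _, by simp⟩

theorem RelUpper.self : RelUpper P P := ⟨le_rfl, fun _ _ _ h _ => h⟩

theorem RelUpper.union {I J : Set α} (hI : RelUpper P I) (hJ : RelUpper P J) :
    RelUpper P (I ∪ J) :=
  ⟨Set.union_subset hI.1 hJ.1, fun D hD E hE h =>
    hD.imp (fun hD => hI.2 D hD E hE h) fun hD => hJ.2 D hD E hE h⟩

theorem RelUpper.inter {I J : Set α} (hI : RelUpper P I) (hJ : RelUpper P J) :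
    RelUpper P (I ∩ J) :=
  ⟨Set.inter_subset_left.trans hI.1, fun D hD E hE h =>
    ⟨hI.2 D hD.1 E hE h, hJ.2 D hD.2 E hE h⟩⟩

/-- The relation `J ⊊ I`, up to finite sets, between subsets closed upwards in `P`. -/
def InfLT (P J I : Set α) : Prop :=
  RelUpper P J ∧ RelUpper P I ∧ J ⊆ I ∧ (I \ J).Infinite

theorem NarrowSet.wellFounded_infLT (hP : NarrowSet n P) : WellFounded (InfLT P) := by
  rw [wellFounded_iff_isEmpty_descending_chain]
  refine ⟨fun ⟨f, hf⟩ => ?_⟩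
  obtain ⟨T, hT, hTa, hTc, -⟩ := exists_antichain_of_chain hP.finite_ge f (fun j => (hf j).2.1)
    (n + 1) (fun j _ => (hf j).2.2.2) (fun j _ => (hf j).2.2.1)
  have := hP.card_le T hT hTa
  omega

theorem NarrowSet.wellFounded_infLT_swap (hP : NarrowSet n P) :
    WellFounded (Function.swap (InfLT P)) := by
  rw [wellFounded_iff_isEmpty_descending_chain]
  refine ⟨fun ⟨f, hf⟩ => ?_⟩
  -- The first `n + 2` terms of the ascending chain are read backwards to give `n + 1` infinite
  -- descending steps.
  obtain ⟨T, hT, hTa, hTc, -⟩ := exists_antichain_of_chain hP.finite_ge (fun j => f (n + 1 - j))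
    (fun j => (hf _).1) (n + 1)
    (fun j hj => by
      have := (hf (n + 1 - (j + 1))).2.2.2
      rwa [show n + 1 - (j + 1) + 1 = n + 1 - j by omega] at this)
    (fun j hj => by
      have := (hf (n + 1 - (j + 1))).2.2.1
      rwa [show n + 1 - (j + 1) + 1 = n + 1 - j by omega] at this)
  have := hP.card_le T hT hTa
  omega

/-- A difference of two upwards closed subsets of `P` that no upwards closed subset splits into
two infinite parts. -/
structure IsAtomic (P A : Set α) : Prop where
  exists_sdiff : ∃ I J, RelUpper P I ∧ RelUpper P J ∧ J ⊆ I ∧ A = I \ J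
  split : ∀ J, RelUpper P J → (A ∩ J).Finite ∨ (A \ J).Finite

theorem IsAtomic.subset {A : Set α} (hA : IsAtomic P A) : A ⊆ P := by
  obtain ⟨I, J, hI, -, -, rfl⟩ := hA.exists_sdiff
  exact Set.sdiff_subset.trans hI.1

/-- Noetherian induction: if `J` is maximal among the upper sets infinitely smaller than `I`, then
`I \ J` is atomic, and `J` is decomposed by induction. If there is no such `J`, then `I` is finite.
-/
theorem NarrowSet.exists_atoms (hP : NarrowSet n P) {I : Set α} (hI : RelUpper P I) :
    ∃ 𝒜 : Set (Set α), 𝒜.Finite ∧ I = ⋃₀ 𝒜 ∧ ∀ A ∈ 𝒜, IsAtomic P A := by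
  induction I using hP.wellFounded_infLT.induction with | _ I ih =>
  by_cases hne : {J | InfLT P J I}.Nonempty
  · obtain ⟨J, hJ, hmax⟩ := hP.wellFounded_infLT_swap.has_min _ hne
    obtain ⟨𝒜, h𝒜, hJ𝒜, hat⟩ := ih J hJ hJ.1
    refine ⟨insert (I \ J) 𝒜, h𝒜.insert _, ?_, ?_⟩
    · rw [Set.sUnion_insert, ← hJ𝒜, Set.sdiff_union_of_subset hJ.2.2.1]
    · rintro A (rfl | hA)
      · refine ⟨⟨I, J, hI, hJ.1, hJ.2.2.1, rfl⟩, fun K hK => ?_⟩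
        have hJ' : RelUpper P (J ∪ I ∩ K) := hJ.1.union (hI.inter hK)
        have hsub : J ∪ I ∩ K ⊆ I := Set.union_subset hJ.2.2.1 Set.inter_subset_left
        by_cases hfin : (I \ (J ∪ I ∩ K)).Finite
        · right
          refine hfin.subset fun a ha => ⟨ha.1.1, ?_⟩
          rintro (h | h)
          exacts [ha.1.2 h, ha.2 h.2]
        · left
          have := hmax _ (show InfLT P (J ∪ I ∩ K) I from ⟨hJ', hI, hsub, hfin⟩)
          by_contra hinf
          refine this ⟨hJ.1, hJ', Set.subset_union_left, fun hf => hinf (hf.subset ?_)⟩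
          exact fun a ha => ⟨Or.inr ⟨ha.1.1, ha.2⟩, ha.1.2⟩
      · exact hat A hA
  · have hfin : I.Finite := by
      by_contra hinf
      exact hne ⟨∅, RelUpper.empty, hI, Set.empty_subset _, by rwa [Set.sdiff_empty]⟩
    refine ⟨{I}, Set.finite_singleton _, (Set.sUnion_singleton _).symm, ?_⟩
    rintro A rfl
    exact ⟨⟨A, ∅, hI, RelUpper.empty, Set.empty_subset _, Set.sdiff_empty.symm⟩,
      fun J _ => Or.inl (hfin.subset Set.inter_subset_left)⟩

/-- Up to finite sets, there are only finitely many upwards closed subsets. -/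
theorem NarrowSet.finite_of_commensurate_injective (hP : NarrowSet n P) {β : Type*} (S : Set β)
    (F : β → Set α) (hF : ∀ b ∈ S, RelUpper P (F b))
    (hinj : ∀ b ∈ S, ∀ c ∈ S, Commensurate (F b) (F c) → b = c) : S.Finite := by
  obtain ⟨𝒜, h𝒜, hP𝒜, hat⟩ := hP.exists_atoms RelUpper.self
  -- An upper set almost contains every atom it meets infinitely often, so these atoms determine it
  -- up to a finite set.
  refine Set.Finite.of_finite_image (f := fun b => {A ∈ 𝒜 | (A ∩ F b).Infinite})
    (h𝒜.finite_subsets.subset ?_) fun b hb c hc hbc => hinj b hb c hc ?_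
  · rintro _ ⟨b, -, rfl⟩
    exact fun A hA => hA.1
  · have key : ∀ b ∈ S, ∀ c ∈ S, {A ∈ 𝒜 | (A ∩ F b).Infinite} = {A ∈ 𝒜 | (A ∩ F c).Infinite} →
        (F b \ F c).Finite := by
      intro b hb c hc hbc
      have hU : (⋃ A ∈ 𝒜, (A ∩ F b) \ F c).Finite := by
        refine h𝒜.biUnion fun A hA => ?_
        by_cases hfin : (A ∩ F b).Finite
        · exact hfin.sdiff
        · have : A ∈ {A ∈ 𝒜 | (A ∩ F c).Infinite} := hbc ▸ ⟨hA, hfin⟩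
          exact (((hat A hA).split _ (hF c hc)).resolve_left this.2).subset
            (Set.sdiff_subset_sdiff_left Set.inter_subset_left)
      refine hU.subset fun a ha => ?_
      have haP := (hF b hb).1 ha.1
      rw [hP𝒜] at haP
      obtain ⟨A, hA, haA⟩ := haP
      exact Set.mem_biUnion hA ⟨⟨haA, ha.1⟩, ha.2⟩
    exact ⟨key b hb c hc hbc, key c hc b hb hbc.symm⟩

/-- All but finitely many elements of an atomic set dominate all but finitely many elements. -/
theorem NarrowSet.finite_bad (hP : NarrowSet n P) {A : Set α} (hA : IsAtomic P A) :
    {D ∈ A | {E ∈ A | ¬ E ≤ D}.Infinite}.Finite := by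
  -- The elements of `P` not below a bad `D` form an upper set meeting `A` infinitely often, so by
  -- atomicity only finitely many elements of `A` are below `D`.
  refine hP.finite_of_finite_le (fun D hD => hA.subset hD.1) fun D hD => ?_
  have hK : RelUpper P {E ∈ P | ¬ E ≤ D} :=
    ⟨fun E hE => hE.1, fun E hE F hF h => ⟨hF, fun hFD => hE.2 (h.trans hFD)⟩⟩
  rcases hA.split _ hK with h | h
  · exact (hD.2 (h.subset fun E hE => ⟨hE.1, hA.subset hE.1, hE.2⟩)).elim
  · exact h.subset fun E hE => ⟨hE.1.1, fun h => h.2 hE.2⟩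

end Width

/-! ### Automorphisms with vanishing transfer -/

section Invariant

variable {Γ α : Type*} [Group Γ] [PartialOrder α] [MulAction Γ α]

/-- Let `β D` count the elements of `A` above `D`. Almost every `D` lies below the whole finite
symmetric difference of `A` and `g⁻¹ • A`; since its two halves have equal size, `β (g • D) = β D`.
Discarding the low levels of `β` leaves an invariant set. -/
theorem exists_smul_eq_self_of_directed (hm : ∀ (g : Γ) (a b : α), a ≤ b → g • a ≤ g • b) (g : Γ)
    {A : Set α} (hb : ∀ D ∈ A, {E ∈ A | ¬ E ≤ D}.Finite) (hf : ∀ D ∈ A, {E ∈ A | D ≤ E}.Finite)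
    (hc : Commensurate A (g • A)) (ht : transfer A (g • A) = 0) :
    ∃ F ⊆ A, (A \ F).Finite ∧ g • F = F := by
  have hm' : ∀ a b : α, g • a ≤ g • b → a ≤ b := fun a b h => by
    simpa using hm g⁻¹ _ _ h
  obtain ⟨B, hB⟩ : ∃ B, B = g⁻¹ • A := ⟨_, rfl⟩
  have memB : ∀ D, D ∈ B ↔ g • D ∈ A := fun D => by rw [hB, Set.mem_inv_smul_set_iff]
  have hcB : Commensurate B A := by
    have := hc.smul g⁻¹
    rwa [inv_smul_smul, ← hB] at this
  have hcard : (B \ A).ncard = (A \ B).ncard := by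
    rw [← transfer_smul g⁻¹, inv_smul_smul, ← hB] at ht
    unfold transfer at ht
    omega
  obtain ⟨β, hβ⟩ : ∃ β : α → ℕ, ∀ D, β D = {E ∈ A | D ≤ E}.ncard := ⟨_, fun _ => rfl⟩
  let Good : Set α := {D | g • D ∈ A ∧ (∀ E ∈ A \ B, D ≤ E) ∧ ∀ E ∈ B \ A, D ≤ E}
  have hbad : (A \ Good).Finite := by
    have h1 : (⋃ E ∈ A \ B, {D ∈ A | ¬ D ≤ E}).Finite := hcB.2.biUnion fun E hE => hb E hE.1
    have h2 : (⋃ E ∈ B \ A, (g • ·) ⁻¹' {D ∈ A | ¬ D ≤ g • E}).Finite :=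
      hcB.1.biUnion fun E hE =>
        (hb _ ((memB E).1 hE.1)).preimage (MulAction.injective g).injOn
    refine ((hcB.2.union h1).union h2).subset fun D hD => ?_
    by_contra hn
    simp only [Set.mem_union, not_or, Set.mem_iUnion, not_exists] at hn
    have hDB : D ∈ B := by_contra fun h => hn.1.1 ⟨hD.1, h⟩
    refine hD.2 ⟨(memB D).1 hDB, fun E hE => ?_, fun E hE => ?_⟩
    · by_contra h
      exact hn.1.2 E hE ⟨hD.1, h⟩
    · by_contra h
      exact hn.2 E hE ⟨(memB D).1 hDB, fun h' => h (hm' _ _ h')⟩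
  have hgood : ∀ D ∈ A, D ∈ Good → β (g • D) = β D := by
    rintro D hD ⟨-, h1, h2⟩
    have e1 : {E ∈ A | g • D ≤ E} = g • {E ∈ B | D ≤ E} := by
      ext E
      rw [Set.mem_smul_set_iff_inv_smul_mem]
      simp only [Set.mem_ofPred_eq, memB, smul_inv_smul]
      refine and_congr_right fun _ => ⟨fun h => ?_, fun h => ?_⟩
      · simpa using hm g⁻¹ _ _ h
      · simpa using hm g _ _ h
    rw [hβ, hβ, e1, Set.ncard_smul_set]
    have hS := hf D hD
    have hST : {E ∈ A | D ≤ E} \ {E ∈ B | D ≤ E} = A \ B := by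
      ext E
      exact ⟨fun h => ⟨h.1.1, fun hE => h.2 ⟨hE, h.1.2⟩⟩,
        fun h => ⟨⟨h.1, h1 E h⟩, fun hE => h.2 hE.1⟩⟩
    have hTS : {E ∈ B | D ≤ E} \ {E ∈ A | D ≤ E} = B \ A := by
      ext E
      exact ⟨fun h => ⟨h.1.1, fun hE => h.2 ⟨hE, h.1.2⟩⟩,
        fun h => ⟨⟨h.1, h2 E h⟩, fun hE => h.2 hE.1⟩⟩
    have hT : {E ∈ B | D ≤ E}.Finite := (hS.union hcB.1).subset fun E hE => by
      by_cases hEA : E ∈ A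
      exacts [Or.inl ⟨hEA, hE.2⟩, Or.inr ⟨hE.1, hEA⟩]
    rw [← Set.ncard_inter_add_ncard_sdiff_eq_ncard _ {E ∈ A | D ≤ E} hT, hTS,
      ← Set.ncard_inter_add_ncard_sdiff_eq_ncard _ {E ∈ B | D ≤ E} hS, hST, hcard, Set.inter_comm]
  have hproper : ∀ k, {D ∈ A | β D ≤ k}.Finite := by
    intro k
    by_cases hA : A.Finite
    · exact hA.subset fun D hD => hD.1
    · obtain ⟨t, htA, htk⟩ := Set.Infinite.exists_subset_card_eq hA (k + 1)
      -- Almost every element lies below all `k + 1` members of `t`, hence has `β` larger than `k`.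
      refine (t.finite_toSet.biUnion fun d hd => hb d (htA hd)).subset fun E hE => ?_
      by_contra hn
      simp only [Set.mem_iUnion, not_exists] at hn
      have hsub : (t : Set α) ⊆ {D ∈ A | E ≤ D} := fun d hd =>
        ⟨htA hd, by_contra fun h => hn d hd ⟨hE.1, h⟩⟩
      have := Set.ncard_le_ncard hsub (hf E hE.1)
      rw [Set.ncard_coe_finset, ← hβ] at this
      have := hE.2
      omega
  obtain ⟨K, hK⟩ := (hbad.image β).bddAbove
  have hK' : ∀ D ∈ A, K < β D → D ∈ Good := fun D hD hDK => by
    by_contra h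
    have : β D ≤ K := hK ⟨D, ⟨hD, h⟩, rfl⟩
    omega
  refine ⟨{D ∈ A | K < β D}, fun D hD => hD.1, (hproper K).subset ?_, ?_⟩
  · exact fun D hD => ⟨hD.1, by_contra fun h => hD.2 ⟨hD.1, not_le.1 h⟩⟩
  · refine Set.Subset.antisymm ?_ fun D hD => ?_
    · rintro _ ⟨D, hD, rfl⟩
      have hg := hK' D hD.1 hD.2
      exact ⟨hg.1, by rw [hgood D hD.1 hg]; exact hD.2⟩
    · have hL : {E ∈ A | β E = β D}.Finite := (hproper (β D)).subset fun E hE => ⟨hE.1, hE.2.le⟩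
      have hsub : g • {E ∈ A | β E = β D} ⊆ {E ∈ A | β E = β D} := by
        rintro _ ⟨E, hE, rfl⟩
        have hg := hK' E hE.1 (hE.2 ▸ hD.2)
        exact ⟨hg.1, by rw [hgood E hE.1 hg]; exact hE.2⟩
      have heq := Set.eq_of_subset_of_ncard_le hsub (Set.ncard_smul_set g _).ge hL
      have hDL : D ∈ g • {E ∈ A | β E = β D} := by
        rw [heq]; exact ⟨hD.1, rfl⟩
      obtain ⟨E, hE, rfl⟩ := hDL
      exact ⟨E, ⟨hE.1, hE.2 ▸ hD.2⟩, rfl⟩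

/-- If all the upwards closed subsets of a narrow set are commensurated with vanishing transfer,
then a cofinite subset is invariant. -/
theorem NarrowSet.exists_smul_eq_self {n : ℕ} {P : Set α} (hP : NarrowSet n P)
    (hm : ∀ (g : Γ) (a b : α), a ≤ b → g • a ≤ g • b) (g : Γ)
    (h : ∀ I, RelUpper P I → Commensurate I (g • I) ∧ transfer I (g • I) = 0) :
    ∃ F ⊆ P, (P \ F).Finite ∧ g • F = F := by
  obtain ⟨𝒜, h𝒜, hP𝒜, hat⟩ := hP.exists_atoms RelUpper.self
  have key : ∀ A ∈ 𝒜, ∃ F ⊆ A, (A \ F).Finite ∧ g • F = F := by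
    intro A hA
    obtain ⟨I, J, hI, hJ, hJI, rfl⟩ := (hat A hA).exists_sdiff
    have hc : Commensurate (I \ J) (g • (I \ J)) := by
      rw [Set.smul_set_sdiff]
      exact (h I hI).1.sdiff (h J hJ).1
    have ht : transfer (I \ J) (g • (I \ J)) = 0 := by
      rw [Set.smul_set_sdiff, transfer_sdiff hJI (Set.smul_set_mono hJI) (h I hI).1 (h J hJ).1,
        (h I hI).2, (h J hJ).2, sub_zero]
    have hbad := hP.finite_bad (hat _ hA)
    -- Without these finitely many bad elements the atom is directed downwards up to finite sets,
    -- and its transfer is unchanged.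
    obtain ⟨C, hC⟩ : ∃ C, C = {D ∈ I \ J | {E ∈ I \ J | ¬ E ≤ D}.Infinite} := ⟨_, rfl⟩
    rw [← hC] at hbad
    have hCA : C ⊆ I \ J := hC ▸ fun D hD => hD.1
    obtain ⟨F, hF, hF', hgF⟩ := exists_smul_eq_self_of_directed hm g (A := (I \ J) \ C)
      (fun D hD => by
        have : ¬ {E ∈ I \ J | ¬ E ≤ D}.Infinite := fun hinf => hD.2 (hC ▸ ⟨hD.1, hinf⟩)
        exact (Set.not_infinite.1 this).subset fun E hE => ⟨hE.1.1, hE.2⟩)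
      (fun D hD => (hP.finite_ge D ((hat _ hA).subset hD.1)).subset fun E hE =>
        ⟨(hat _ hA).subset hE.1.1, hE.2⟩)
      (by
        rw [Set.smul_set_sdiff]
        exact hc.sdiff (commensurate_of_finite hbad hbad.smul_set))
      (by rw [transfer_sdiff_smul g hCA hbad hc, ht])
    refine ⟨F, hF.trans Set.sdiff_subset, (hF'.union hbad).subset fun a ha => ?_, hgF⟩
    by_cases haC : a ∈ C
    exacts [Or.inr haC, Or.inl ⟨⟨ha.1, haC⟩, ha.2⟩]
  choose! F hFA hfin hgF using key
  refine ⟨⋃ A ∈ 𝒜, F A, ?_, (h𝒜.biUnion hfin).subset fun a ha => ?_, ?_⟩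
  · refine Set.iUnion₂_subset fun A hA => (hFA A hA).trans ?_
    rw [hP𝒜]
    exact Set.subset_sUnion_of_mem hA
  · have haP := ha.1
    rw [hP𝒜] at haP
    obtain ⟨A, hA, haA⟩ := haP
    exact Set.mem_biUnion hA ⟨haA, fun h => ha.2 (Set.mem_biUnion hA h)⟩
  · rw [Set.smul_set_iUnion₂]
    exact Set.iUnion₂_congr hgF

end Invariant

/-! ### From halfspaces and components of the boundary to narrow posets, and back to displacements.
-/

section Roller

variable {V : Type*} {G : SimpleGraph V}

/-! ### Halfspaces separating a vertex from an orientation or a component -/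

/-- The halfspaces chosen by `σ` that do not contain `x`. -/
def chosenAvoiding (x : V) (σ : Orientation G) : Set (Set V) :=
  {D | (∃ J, σ.side J = D) ∧ x ∉ D}

/-- The halfspaces containing `Y` but not `x`. -/
def containingAvoiding (x : V) (Y : Component G) : Set (Set V) :=
  {D | IsHalfspace G D ∧ ContainedIn Y D ∧ x ∉ D}

theorem IsMedian.side_eq_of_exists (hG : IsMedian G) {σ : Orientation G} {J : Hyperplane G}
    {D : Set V} (hD : D ∈ J.halfspaces) (h : ∃ K, σ.side K = D) : σ.side J = D := by
  obtain ⟨K, rfl⟩ := h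
  rw [hG.hyperplane_unique hD (σ.side_mem K)]

/-- Orientations are closed upwards: the complement of `E` would miss `σ.side K`. -/
theorem IsMedian.side_eq_of_subset (hG : IsMedian G) {σ : Orientation G} {J K : Hyperplane G}
    {E : Set V} (hE : E ∈ J.halfspaces) (h : σ.side K ⊆ E) : σ.side J = E := by
  refine (hG.eq_or_eq_compl hE (σ.side_mem J)).resolve_right fun hc => ?_
  obtain ⟨p, hp1, hp2⟩ := σ.inter_nonempty J K
  rw [hc] at hp1
  exact hp1 (h hp2)

theorem IsMedian.side_injective (hG : IsMedian G) (σ : Orientation G) :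
    Function.Injective σ.side := fun J K h =>
  hG.hyperplane_unique (σ.side_mem J) (h ▸ σ.side_mem K)

theorem IsMedian.containedIn_of_subset (hG : IsMedian G) {Y : Component G} {D E : Set V}
    (hD : ContainedIn Y D) (hE : IsHalfspace G E) (h : D ⊆ E) : ContainedIn Y E := by
  intro σ hσ
  obtain ⟨K, rfl⟩ := hD σ hσ
  obtain ⟨J, hJ⟩ := hE
  exact ⟨J, hG.side_eq_of_subset hJ h⟩

theorem IsHalfspace.nonempty {D : Set V} (hD : IsHalfspace G D) : D.Nonempty :=
  nonempty_of_mem_halfspaces hD.choose_spec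

theorem finite_halfspaces_separating (hG : G.Connected) (p x : V) :
    {E | IsHalfspace G E ∧ p ∈ E ∧ x ∉ E}.Finite := by
  refine ((sep_principal_finite hG p x).image fun J => J.sideOf p).subset ?_
  rintro E ⟨⟨J, hJ⟩, hp, hx⟩
  have := Hyperplane.sideOf_eq_of_mem hJ hp
  exact ⟨J, mem_sep_principal.2 (this ▸ hx), this⟩

theorem containingAvoiding_subset {x : V} {Y : Component G}
    {σ : Orientation G} (hσ : σ ∈ Y.supp) : containingAvoiding x Y ⊆ chosenAvoiding x σ :=
  fun _ hD => ⟨hD.2.1 σ hσ, hD.2.2⟩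

theorem isHalfspace_of_mem {x : V} {σ : Orientation G} {D : Set V}
    (h : D ∈ chosenAvoiding x σ) : IsHalfspace G D := by
  obtain ⟨⟨J, rfl⟩, -⟩ := h
  exact ⟨J, σ.side_mem J⟩

theorem IsMedian.mem_chosenAvoiding_of_subset (hG : IsMedian G) {x : V} {σ : Orientation G}
    {J : Hyperplane G} {E : Set V} (hE : IsHalfspace G E) (hx : x ∉ E) (h : σ.side J ⊆ E) :
    E ∈ chosenAvoiding x σ := by
  obtain ⟨K, hK⟩ := hE
  exact ⟨⟨K, hG.side_eq_of_subset hK h⟩, hx⟩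

theorem IsMedian.relUpper_trans (hG : IsMedian G) {x : V} {Y : Component G} {σ : Orientation G}
    (hσ : σ ∈ Y.supp) {I : Set (Set V)} (hI : RelUpper (containingAvoiding x Y) I) :
    RelUpper (chosenAvoiding x σ) I :=
  ⟨hI.1.trans (containingAvoiding_subset hσ), fun D hD E hE h => hI.2 D hD E
    ⟨isHalfspace_of_mem hE, hG.containedIn_of_subset (hI.1 hD).2.1 (isHalfspace_of_mem hE) h, hE.2⟩
    h⟩

/-! ### Truncated orientations -/

open scoped Classical in
/-- The orientation that follows `σ` on the halfspaces of `I` and otherwise points to `x`. -/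
noncomputable def truncate (hG : IsMedian G) (x : V) (σ : Orientation G) (I : Set (Set V))
    (hI : RelUpper (chosenAvoiding x σ) I) : Orientation G where
  side J := if σ.side J ∈ I then σ.side J else J.sideOf x
  side_mem J := by
    split_ifs
    exacts [σ.side_mem J, J.sideOf_mem x]
  inter_nonempty := by
    -- If these sides were disjoint, the side of `K` avoiding `x` would contain `σ.side J`, so it
    -- would be chosen by `σ` and belong to the upper set `I`.
    have key : ∀ J K, σ.side J ∈ I → σ.side K ∉ I → (σ.side J ∩ K.sideOf x).Nonempty := by
      intro J K hJ hK
      by_contra hem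
      have hsub : σ.side J ⊆ (K.sideOf x)ᶜ := fun p hp hpK => hem ⟨p, hp, hpK⟩
      have hc := hG.compl_mem_halfspaces (K.sideOf_mem x)
      have hx : x ∉ (K.sideOf x)ᶜ := fun h => h (K.mem_sideOf x)
      have := hI.2 _ hJ _ (hG.mem_chosenAvoiding_of_subset ⟨K, hc⟩ hx hsub) hsub
      rw [← hG.side_eq_of_subset hc hsub] at this
      exact hK this
    intro J K
    split_ifs with hJ hK hK
    · exact σ.inter_nonempty J K
    · exact key J K hJ hK
    · rw [Set.inter_comm]; exact key K J hK hJ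
    · exact ⟨x, J.mem_sideOf x, K.mem_sideOf x⟩

section Truncate

variable {hG : IsMedian G} {x : V} {σ : Orientation G} {I : Set (Set V)}
  {hI : RelUpper (chosenAvoiding x σ) I} {J : Hyperplane G}

theorem truncate_side_of_mem (h : σ.side J ∈ I) : (truncate hG x σ I hI).side J = σ.side J :=
  if_pos h

theorem truncate_side_of_notMem (h : σ.side J ∉ I) :
    (truncate hG x σ I hI).side J = J.sideOf x :=
  if_neg h

theorem chosenAvoiding_truncate : chosenAvoiding x (truncate hG x σ I hI) = I := by
  ext D
  constructor
  · rintro ⟨⟨J, rfl⟩, hx⟩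
    by_cases h : σ.side J ∈ I
    · rwa [truncate_side_of_mem h]
    · rw [truncate_side_of_notMem h] at hx
      exact (hx (J.mem_sideOf x)).elim
  · intro hD
    obtain ⟨⟨J, rfl⟩, hx⟩ := hI.1 hD
    exact ⟨⟨J, truncate_side_of_mem hD⟩, hx⟩

theorem sep_truncate {I' : Set (Set V)} {hI' : RelUpper (chosenAvoiding x σ) I'} :
    sep (truncate hG x σ I hI) (truncate hG x σ I' hI') =
      {J | ¬ (σ.side J ∈ I ↔ σ.side J ∈ I')} := by
  have key : ∀ {I}, RelUpper (chosenAvoiding x σ) I → ∀ J, σ.side J ∈ I →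
      σ.side J ≠ J.sideOf x := by
    intro I hI J h he
    exact (hI.1 h).2 (he ▸ J.mem_sideOf x)
  ext J
  by_cases h : σ.side J ∈ I <;> by_cases h' : σ.side J ∈ I'
  · simp [sep, truncate_side_of_mem, h, h']
  · simp [sep, truncate_side_of_mem, truncate_side_of_notMem, h, h', key hI J h]
  · simp [sep, truncate_side_of_mem, truncate_side_of_notMem, h, h', (key hI' J h').symm]
  · simp [sep, truncate_side_of_notMem, h, h']

theorem sep_truncate_principal :
    sep (truncate hG x σ I hI) (principal G x) = σ.side ⁻¹' I := by
  have : principal G x = truncate hG x σ ∅ RelUpper.empty :=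
    Orientation.ext (funext fun J => (truncate_side_of_notMem (Set.notMem_empty _)).symm)
  rw [this, sep_truncate]
  ext J
  simp

theorem exists_truncate_eq_principal (hfin : I.Finite) :
    ∃ v, truncate hG x σ I hI = principal G v :=
  hG.exists_principal (by
    rw [sep_truncate_principal]
    exact hfin.preimage (hG.side_injective σ).injOn)

end Truncate

/-! ### Antichains of halfspaces span cubes -/

theorem IsMedian.exists_cube (hG : IsMedian G) {x : V} {σ : Orientation G} {d : ℕ}
    (D : Fin d → Set V) (hD : ∀ i, D i ∈ chosenAvoiding x σ) (hinj : Function.Injective D)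
    (hanti : ∀ i j, D i ⊆ D j → i = j) : Nonempty (cubeGraph d ↪g G) := by
  -- Everything strictly above the antichain is always followed, and `u` decides which `D i` are.
  -- These upper sets are finite, so their truncations are vertices, and two of them differ exactly
  -- on the coordinates where the words differ.
  let I : (Fin d → Bool) → Set (Set V) := fun u =>
    {E ∈ chosenAvoiding x σ | (∃ i, D i ⊂ E) ∨ ∃ i, u i = true ∧ E = D i}
  have hI : ∀ u, RelUpper (chosenAvoiding x σ) (I u) := by
    refine fun u => ⟨fun E hE => hE.1, ?_⟩
    rintro E ⟨-, ⟨i, hi⟩ | ⟨i, hi, rfl⟩⟩ F hF hEF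
    · exact ⟨hF, Or.inl ⟨i, hi.trans_le hEF⟩⟩
    · rcases eq_or_lt_of_le hEF with h | h
      · exact ⟨hF, Or.inr ⟨i, hi, h.symm⟩⟩
      · exact ⟨hF, Or.inl ⟨i, h⟩⟩
  have hfin : ∀ u, (I u).Finite := by
    intro u
    choose p hp using fun i => (isHalfspace_of_mem (hD i)).nonempty
    refine (Set.finite_iUnion fun i =>
      finite_halfspaces_separating hG.connected (p i) x).subset ?_
    rintro E ⟨hE, h⟩
    have : ∃ i, D i ⊆ E := by
      rcases h with ⟨i, hi⟩ | ⟨i, -, rfl⟩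
      exacts [⟨i, hi.subset⟩, ⟨i, le_rfl⟩]
    obtain ⟨i, hi⟩ := this
    exact Set.mem_iUnion.2 ⟨i, isHalfspace_of_mem hE, hi (hp i), hE.2⟩
  choose v hv using fun u => exists_truncate_eq_principal (hG := hG) (hI := hI u) (hfin u)
  choose J hJ using fun i => (hD i).1
  have hJinj : Function.Injective J := fun i j h => hinj (by rw [← hJ, ← hJ, h])
  have hmem : ∀ u i, D i ∈ I u ↔ u i = true := by
    intro u i
    constructor
    · rintro ⟨-, ⟨j, hj⟩ | ⟨j, hj, he⟩⟩
      · exact (hj.ne (congrArg D (hanti j i hj.subset))).elim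
      · rwa [hinj he]
    · exact fun h => ⟨hD i, Or.inr ⟨i, h, rfl⟩⟩
  have hsep : ∀ u w, sep (principal G (v u)) (principal G (v w)) = J '' {i | u i ≠ w i} := by
    intro u w
    rw [← hv, ← hv, sep_truncate]
    ext K
    constructor
    · intro hK
      have : ∃ i, σ.side K = D i := by
        by_contra hne
        push Not at hne
        refine hK ⟨?_, ?_⟩
        · rintro ⟨h, h' | ⟨i, -, hi⟩⟩
          exacts [⟨h, Or.inl h'⟩, (hne i hi).elim]
        · rintro ⟨h, h' | ⟨i, -, hi⟩⟩
          exacts [⟨h, Or.inl h'⟩, (hne i hi).elim]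
      obtain ⟨i, hi⟩ := this
      refine ⟨i, fun he => hK ?_, hG.side_injective σ (by rw [hJ, hi])⟩
      rw [hi, hmem, hmem, he]
    · rintro ⟨i, hi, rfl⟩ he
      rw [hJ, hmem, hmem] at he
      exact hi (Bool.eq_iff_iff.2 he)
  refine ⟨⟨⟨v, fun u w h => ?_⟩, fun {u w} => ?_⟩⟩
  · funext i
    by_contra hi
    have : J i ∈ sep (principal G (v u)) (principal G (v w)) := hsep u w ▸ ⟨i, hi, rfl⟩
    rw [h] at this
    exact this rfl
  · change G.Adj (v u) (v w) ↔ ∃! i, u i ≠ w i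
    rw [hG.adj_iff_existsUnique]
    change (∃! K, K ∈ sep (principal G (v u)) (principal G (v w))) ↔ _
    rw [hsep]
    constructor
    · rintro ⟨_, ⟨i, hi, rfl⟩, hu⟩
      exact ⟨i, hi, fun j hj => hJinj (hu _ ⟨j, hj, rfl⟩)⟩
    · rintro ⟨i, hi, hu⟩
      refine ⟨J i, ⟨i, hi, rfl⟩, ?_⟩
      rintro _ ⟨j, hj, rfl⟩
      rw [hu j hj]

theorem IsMedian.narrowSet (hG : IsMedian G) {n : ℕ}
    (hn : ∀ d : ℕ, Nonempty (cubeGraph d ↪g G) → d ≤ n) (x : V) (σ : Orientation G) :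
    NarrowSet n (chosenAvoiding x σ) where
  finite_ge D hD := by
    obtain ⟨p, hp⟩ := (isHalfspace_of_mem hD).nonempty
    exact (finite_halfspaces_separating hG.connected p x).subset fun E hE =>
      ⟨isHalfspace_of_mem hE.1, hE.2 hp, hE.1.2⟩
  card_le T hT hanti := by
    refine hn _ (hG.exists_cube (fun i => (T.equivFin.symm i : Set V)) (fun i => hT (Subtype.prop _))
      (Subtype.val_injective.comp T.equivFin.symm.injective) fun i j hij => ?_)
    by_contra hne
    exact hanti (Subtype.prop _) (Subtype.prop _)
      (fun h => hne (T.equivFin.symm.injective (Subtype.ext h))) hij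

/-! ### Components of the boundary preceding a given one -/

theorem exists_notMem_of_strictAnti (hG : G.Connected) {D : ℕ → Set V} (hD : StrictAnti D)
    (hh : ∀ i, IsHalfspace G (D i)) (x : V) : ∃ i, x ∉ D i := by
  by_contra! hx
  -- Were `x` in every term, infinitely many halfspaces would separate `x` from this vertex of `D 0
  -- \ D 1`.
  obtain ⟨p, -, hp⟩ := Set.exists_of_ssubset (hD Nat.zero_lt_one)
  have hinj : Function.Injective fun i => D (i + 1) := fun i j h =>
    Nat.succ_injective (hD.injective h)
  refine Set.infinite_range_of_injective hinj ((finite_halfspaces_separating hG x p).subset ?_)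
  rintro _ ⟨i, rfl⟩
  exact ⟨hh _, hx _, fun h => hp (hD.antitone (by omega) h)⟩

/-- Otherwise there is a decreasing sequence of such halfspaces. Some `τ` in `Y` does not choose the
first one, hence by upward closure none of them, so it differs from `σ` on infinitely many
hyperplanes. -/
theorem IsMedian.finite_crossing (hG : IsMedian G) {n : ℕ}
    (hn : ∀ d : ℕ, Nonempty (cubeGraph d ↪g G) → d ≤ n) (x : V) {Y : Component G}
    {σ : Orientation G} (hσ : σ ∈ Y.supp) :
    (chosenAvoiding x σ \ containingAvoiding x Y).Finite := by
  by_contra hinf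
  obtain ⟨D, hD, hDmem⟩ := (hG.narrowSet hn x σ).exists_strictAnti Set.sdiff_subset hinf
  have h0 : ¬ ContainedIn Y (D 0) := fun h =>
    (hDmem 0).2 ⟨isHalfspace_of_mem (hDmem 0).1, h, (hDmem 0).1.2⟩
  simp only [ContainedIn, not_forall] at h0
  obtain ⟨τ, hτ, hτD⟩ := h0
  choose J hJ using fun i => (hDmem i).1.1
  have hJinj : Function.Injective J := fun i j h => hD.injective (by rw [← hJ, ← hJ, h])
  refine Set.infinite_range_of_injective hJinj (((hG.mem_supp_iff hσ).1 hτ).subset ?_)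
  rintro _ ⟨i, rfl⟩ he
  refine hτD ⟨J 0, hG.side_eq_of_subset (K := J i) (hJ 0 ▸ σ.side_mem (J 0)) ?_⟩
  rw [← he, hJ]
  exact hD.antitone (Nat.zero_le i)

theorem IsMedian.commensurate_of_mem (hG : IsMedian G) {n : ℕ}
    (hn : ∀ d : ℕ, Nonempty (cubeGraph d ↪g G) → d ≤ n) (x : V) {Y : Component G}
    {σ : Orientation G} (hσ : σ ∈ Y.supp) :
    Commensurate (containingAvoiding x Y) (chosenAvoiding x σ) :=
  ⟨by rw [Set.sdiff_eq_empty.2 (containingAvoiding_subset hσ)]; exact Set.finite_empty,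
    hG.finite_crossing hn x hσ⟩

/-- An infinite difference would contain a direction to `Z` none of whose terms contains `Y`. -/
theorem IsMedian.finite_of_prec (hG : IsMedian G) {n : ℕ}
    (hn : ∀ d : ℕ, Nonempty (cubeGraph d ↪g G) → d ≤ n) (x : V) {Y Z : Component G}
    (h : Prec Z Y) : (containingAvoiding x Z \ containingAvoiding x Y).Finite := by
  by_contra hinf
  obtain ⟨τ, hτ⟩ := Z.nonempty_supp
  obtain ⟨D, hD, hDmem⟩ := (hG.narrowSet hn x τ).exists_strictAnti
    (Set.sdiff_subset.trans (containingAvoiding_subset hτ)) hinf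
  have := (h D ⟨hD, fun i => (hDmem i).1.1, fun i => (hDmem i).1.2.1⟩).2.2 0
  exact (hDmem 0).2 ⟨(hDmem 0).1.1, this, (hDmem 0).1.2.2⟩

/-- Where two orientations differ, exactly one of the chosen sides avoids `x`, so their distance is
read off the symmetric difference of the sets of chosen halfspaces avoiding `x`. -/
theorem IsMedian.eq_of_commensurate (hG : IsMedian G) {n : ℕ}
    (hn : ∀ d : ℕ, Nonempty (cubeGraph d ↪g G) → d ≤ n) (x : V) {Y Z : Component G}
    (h : Commensurate (containingAvoiding x Y) (containingAvoiding x Z)) : Y = Z := by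
  obtain ⟨σ, hσ⟩ := Y.nonempty_supp
  obtain ⟨τ, hτ⟩ := Z.nonempty_supp
  have hc := ((hG.commensurate_of_mem hn x hσ).symm.trans h).trans (hG.commensurate_of_mem hn x hτ)
  have key : ∀ {σ τ : Orientation G} {J : Hyperplane G}, σ.side J ≠ τ.side J → x ∉ σ.side J →
      σ.side J ∈ chosenAvoiding x σ \ chosenAvoiding x τ := fun {σ τ J} hne hx =>
    ⟨⟨⟨J, rfl⟩, hx⟩, fun hm => hne (hG.side_eq_of_exists (σ.side_mem J) hm.1).symm⟩
  have hfin : (sep σ τ).Finite := by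
    refine ((hc.1.preimage (hG.side_injective σ).injOn).union
      (hc.2.preimage (hG.side_injective τ).injOn)).subset fun J hJ => ?_
    by_cases hx : x ∈ σ.side J
    · refine Or.inr (key (Ne.symm hJ) fun hx' => ?_)
      rw [hG.side_eq_compl hJ] at hx
      exact hx hx'
    · exact Or.inl (key hJ hx)
  have hτY := (hG.mem_supp_iff hσ).2 hfin
  rw [SimpleGraph.ConnectedComponent.mem_supp_iff] at hτY hτ
  rw [← hτY, ← hτ]

theorem IsMedian.finite_precSet (hG : IsMedian G) (hdim : IsFiniteDimensional G)
    (Y : Component G) : (precSet Y).Finite := by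
  obtain ⟨n, hn⟩ := hdim
  obtain ⟨x⟩ := hG.connected.nonempty
  obtain ⟨σ, hσ⟩ := Y.nonempty_supp
  have hP := (hG.narrowSet hn x σ).mono (containingAvoiding_subset (Y := Y) hσ)
  refine hP.finite_of_commensurate_injective (precSet Y)
    (fun Z => containingAvoiding x Z ∩ containingAvoiding x Y) (fun Z _ => ?_) ?_
  · refine ⟨Set.inter_subset_right, fun D hD E hE h => ⟨⟨hE.1, ?_, hE.2.2⟩, hE⟩⟩
    exact hG.containedIn_of_subset hD.1.2.1 hE.1 h
  · intro Z hZ W hW h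
    have key : ∀ {Z}, Z ∈ precSet Y → Commensurate (containingAvoiding x Z)
        (containingAvoiding x Z ∩ containingAvoiding x Y) := fun {Z} hZ =>
      ⟨by rw [Set.sdiff_self_inter]; exact hG.finite_of_prec hn x hZ.2,
        by rw [Set.sdiff_eq_empty.2 Set.inter_subset_left]; exact Set.finite_empty⟩
    exact hG.eq_of_commensurate hn x (((key hZ).trans h).trans (key hW).symm)

/-- `Z` is the component of the truncation to `I`, which is not principal because `I` is infinite.
The halfspaces avoiding `x` that this truncation chooses are those of `I`, and all but finitely many
of them contain the whole of `Z`. -/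
theorem IsMedian.exists_mem_precSet (hG : IsMedian G) {n : ℕ}
    (hn : ∀ d : ℕ, Nonempty (cubeGraph d ↪g G) → d ≤ n) (x : V) (Y : Component G)
    {I : Set (Set V)} (hI : RelUpper (containingAvoiding x Y) I) (hinf : I.Infinite) :
    ∃ Z ∈ precSet Y, containingAvoiding x Z ⊆ I ∧ (I \ containingAvoiding x Z).Finite := by
  obtain ⟨σ, hσ⟩ := Y.nonempty_supp
  have hI' := hG.relUpper_trans hσ hI
  let ζ := truncate hG x σ I hI'
  have hζ : chosenAvoiding x ζ = I := chosenAvoiding_truncate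
  have hmem : ζ ∈ ((rollerGraph G).connectedComponentMk ζ).supp := rfl
  refine ⟨(rollerGraph G).connectedComponentMk ζ, ⟨fun v hv => hinf ?_, fun D hD => ?_⟩, ?_, ?_⟩
  · have h1 := (hG.mem_supp_iff hmem).1 hv
    have h2 := (h1.union (sep_principal_finite hG.connected v x)).subset (sep_subset_union _ _ _)
    rw [sep_truncate_principal] at h2
    refine (h2.image σ.side).subset fun D hD => ?_
    obtain ⟨J, rfl⟩ := (hI'.1 hD).1
    exact ⟨J, hD, rfl⟩
  · obtain ⟨k, hk⟩ := exists_notMem_of_strictAnti hG.connected hD.1 hD.2.1 x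
    refine ⟨hD.1, hD.2.1, fun i => ?_⟩
    -- Far enough along the direction `x` is avoided, so the term is in `I` and contains `Y`; so do
    -- the larger, earlier terms.
    have hm : D (max i k) ∈ chosenAvoiding x ζ :=
      ⟨hD.2.2 _ ζ hmem, fun h => hk (hD.1.antitone (le_max_right i k) h)⟩
    rw [hζ] at hm
    exact hG.containedIn_of_subset (hI.1 hm).2.1 (hD.2.1 i) (hD.1.antitone (le_max_left i k))
  · rw [← hζ]; exact containingAvoiding_subset hmem
  · rw [← hζ]; exact hG.finite_crossing hn x hmem

/-! ### Equivariance -/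

theorem smul_set_eq_image (g : G ≃g G) (D : Set V) : g • D = g '' D := rfl

theorem IsHalfspace.smul {D : Set V} (hD : IsHalfspace G D) (g : G ≃g G) :
    IsHalfspace G (g • D) := by
  obtain ⟨J, hJ⟩ := hD
  exact ⟨g • J, image_mem_halfspaces g hJ⟩

theorem ContainedIn.smul {Y : Component G} {D : Set V} (h : ContainedIn Y D) (g : G ≃g G) :
    ContainedIn (g • Y) (g • D) := by
  intro σ hσ
  have h1 := smul_mem_supp g⁻¹ hσ
  rw [inv_smul_smul] at h1
  obtain ⟨J, hJ⟩ := h _ h1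
  refine ⟨g • J, ?_⟩
  rw [smul_set_eq_image, ← hJ, ← smul_side_smul, smul_inv_smul]

theorem smul_principal (g : G ≃g G) (x : V) : g • principal G x = principal G (g • x) := by
  refine Orientation.ext (funext fun J => ?_)
  refine (Hyperplane.sideOf_eq_of_mem ((g • principal G x).side_mem J) ?_).symm
  rw [smul_side]
  exact ⟨x, Hyperplane.mem_sideOf _ x, rfl⟩

theorem smul_containingAvoiding_subset (g : G ≃g G) (x : V) (Y : Component G) :
    g • containingAvoiding x Y ⊆ containingAvoiding (g • x) (g • Y) := by
  rintro _ ⟨D, ⟨h1, h2, h3⟩, rfl⟩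
  exact ⟨h1.smul g, h2.smul g, fun h => h3 (Set.smul_mem_smul_set_iff.1 h)⟩

theorem smul_containingAvoiding (g : G ≃g G) (x : V) (Y : Component G) :
    g • containingAvoiding x Y = containingAvoiding (g • x) (g • Y) := by
  refine (smul_containingAvoiding_subset g x Y).antisymm ?_
  rw [Set.subset_smul_set_iff]
  simpa using smul_containingAvoiding_subset g⁻¹ (g • x) (g • Y)

theorem IsDirectionTo.smul {D : ℕ → Set V} {Y : Component G} (h : IsDirectionTo D Y)
    (g : G ≃g G) : IsDirectionTo (fun i => g • D i) (g • Y) :=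
  ⟨fun _ _ hij => ⟨Set.smul_set_mono (h.1 hij).1, fun hc => (h.1 hij).2
    (Set.smul_set_subset_smul_set_iff.1 hc)⟩, fun i => (h.2.1 i).smul g, fun i => (h.2.2 i).smul g⟩

theorem Prec.smul {Y Z : Component G} (h : Prec Z Y) (g : G ≃g G) : Prec (g • Z) (g • Y) := by
  intro D hD
  have := hD.smul g⁻¹
  rw [inv_smul_smul] at this
  simpa using (h _ this).smul g

theorem IsBoundary.smul {Y : Component G} (h : IsBoundary Y) (g : G ≃g G) :
    IsBoundary (g • Y) := by
  intro x hx
  have := smul_mem_supp g⁻¹ hx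
  rw [inv_smul_smul, smul_principal] at this
  exact h _ this

theorem smul_mem_precSet {Y Z : Component G} (hZ : Z ∈ precSet Y) {g : G ≃g G}
    (hg : g ∈ stab Y) : g • Z ∈ precSet Y := by
  refine ⟨hZ.1.smul g, ?_⟩
  have := hZ.2.smul g
  rwa [MulAction.mem_stabilizer_iff.1 hg] at this

theorem finiteIndex_stab₀ {Y : Component G} (h : (precSet Y).Finite) :
    ((stab₀ Y).subgroupOf (stab Y)).FiniteIndex := by
  have key : ∀ Z ∈ precSet Y, (MulAction.stabilizer (stab Y) Z).FiniteIndex := by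
    intro Z hZ
    refine ⟨?_⟩
    rw [MulAction.index_stabilizer]
    have hsub : MulAction.orbit (stab Y) Z ⊆ precSet Y := by
      rintro _ ⟨g, rfl⟩
      exact smul_mem_precSet hZ g.2
    exact ((Set.ncard_pos (h.subset hsub)).2 (MulAction.nonempty_orbit Z)).ne'
  have := h.to_subtype
  have hfi := Subgroup.finiteIndex_iInf (f := fun Z : precSet Y =>
    MulAction.stabilizer (stab Y) (Z : Component G)) fun Z => key Z Z.2
  convert hfi using 1
  ext g
  simp only [Subgroup.mem_subgroupOf, stab₀, Subgroup.mem_inf, Subgroup.mem_iInf]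
  exact ⟨fun hg Z => hg.2 Z Z.2, fun hg => ⟨g.2, fun Z hZ => hg ⟨Z, hZ⟩⟩⟩

/-! ### Vanishing transfers -/

/-- Transports horomorphisms from hyperplanes to halfspaces, where inclusion provides the order. -/
theorem IsMedian.image_separating (hG : IsMedian G) (x : V) {Z : Component G} {τ : Orientation G}
    (hτ : τ ∈ Z.supp) : τ.side '' separating x Z = containingAvoiding x Z := by
  ext D
  constructor
  · rintro ⟨J, ⟨D, hD, hx, h⟩, rfl⟩
    rw [h τ hτ]
    exact ⟨⟨J, hD⟩, fun σ hσ => ⟨J, h σ hσ⟩, hx⟩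
  · rintro ⟨⟨J, hJ⟩, h, hx⟩
    exact ⟨J, ⟨D, hJ, hx, fun σ hσ => hG.side_eq_of_exists hJ (h σ hσ)⟩,
      hG.side_eq_of_exists hJ (h τ hτ)⟩

theorem IsMedian.transfer_containingAvoiding (hG : IsMedian G) (x : V) {Z : Component G}
    {g : G ≃g G} (hg : g ∈ stab Z) :
    transfer (containingAvoiding x Z) (g • containingAvoiding x Z) =
      transfer (separating x Z) (g • separating x Z) := by
  obtain ⟨τ, hτ⟩ := Z.nonempty_supp
  rw [MulAction.mem_stabilizer_iff] at hg
  rw [smul_containingAvoiding, smul_separating, hg, ← hG.image_separating x hτ,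
    ← hG.image_separating (g • x) hτ, transfer_image (hG.side_injective τ)]

theorem commensurate_containingAvoiding (hG : G.Connected) (x y : V) (Z : Component G) :
    Commensurate (containingAvoiding x Z) (containingAvoiding y Z) := by
  have key : ∀ x y, (containingAvoiding x Z \ containingAvoiding y Z).Finite := fun x y =>
    (finite_halfspaces_separating hG y x).subset fun D hD =>
      ⟨hD.1.1, by_contra fun hy => hD.2 ⟨hD.1.1, hD.1.2.1, hy⟩, hD.1.2.2⟩
  exact ⟨key x y, key y x⟩

theorem transfer_separating_of_mem_ker (hG : G.Connected) {x : V} {Y : Component G}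
    {g : stab₀ Y} (hg : g ∈ (fullHoromorphism hG x Y).ker) {Z : Component G}
    (hZ : Z ∈ precSet Y) :
    transfer (separating x Z) ((g : G ≃g G) • separating x Z) = 0 := by
  rw [MonoidHom.mem_ker] at hg
  exact congrArg Multiplicative.toAdd (congrFun hg ⟨Z, hZ⟩)

theorem IsMedian.exists_invariant_of_mem_ker (hG : IsMedian G) (hdim : IsFiniteDimensional G)
    {x : V} {Y : Component G} {g : stab₀ Y}
    (hg : g ∈ (fullHoromorphism hG.connected x Y).ker) :
    ∃ F ⊆ containingAvoiding x Y, (containingAvoiding x Y \ F).Finite ∧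
      (g : G ≃g G) • F = F := by
  obtain ⟨n, hn⟩ := hdim
  obtain ⟨σ, hσ⟩ := Y.nonempty_supp
  have hP := (hG.narrowSet hn x σ).mono (containingAvoiding_subset (Y := Y) hσ)
  refine hP.exists_smul_eq_self (fun g _ _ h => Set.smul_set_mono h) (g : G ≃g G) fun I hI => ?_
  by_cases hfin : I.Finite
  · refine ⟨commensurate_of_finite hfin hfin.smul_set, ?_⟩
    rw [transfer_of_finite hfin hfin.smul_set, Set.ncard_smul_set, sub_self]
  · obtain ⟨Z, hZ, hZI, hIZ⟩ := hG.exists_mem_precSet hn x Y hI hfin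
    have hgZ : (g : G ≃g G) ∈ stab Z := stab₀_le hZ g.2
    have h1 : Commensurate I (containingAvoiding x Z) :=
      ⟨hIZ, by rw [Set.sdiff_eq_empty.2 hZI]; exact Set.finite_empty⟩
    have h2 : Commensurate (containingAvoiding x Z) ((g : G ≃g G) • containingAvoiding x Z) := by
      rw [smul_containingAvoiding, MulAction.mem_stabilizer_iff.1 hgZ]
      exact commensurate_containingAvoiding hG.connected _ _ _
    have h3 := (h1.trans h2).trans (h1.symm.smul (g : G ≃g G))
    refine ⟨h3, ?_⟩
    -- Dropping the finite set `I \ containingAvoiding x Z` leaves the transfer unchanged, and what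
    -- remains is the horomorphism of `Z` at `g`.
    rw [← transfer_sdiff_smul (g : G ≃g G) Set.sdiff_subset hIZ h3,
      Set.sdiff_sdiff_cancel_left hZI, hG.transfer_containingAvoiding x hgZ,
      transfer_separating_of_mem_ker hG.connected hg hZ]

/-! ### Comparison of the displacements -/

/-- The hyperplanes on which `σ` chooses a halfspace avoiding `x` and not in `F`. -/
def residual (x : V) (σ : Orientation G) (F : Set (Set V)) : Set (Hyperplane G) :=
  {J | x ∉ σ.side J ∧ σ.side J ∉ F}

theorem IsMedian.residual_finite (hG : IsMedian G) {x : V} {σ : Orientation G}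
    {F : Set (Set V)} (h : (chosenAvoiding x σ \ F).Finite) : (residual x σ F).Finite :=
  (h.preimage (hG.side_injective σ).injOn).subset fun J hJ => ⟨⟨⟨J, rfl⟩, hJ.1⟩, hJ.2⟩

theorem ncard_le_add {α Γ : Type*} [Group Γ] [MulAction Γ α] (h : Γ) {A B E : Set α}
    (hB : B.Finite) (hE : E.Finite) (hsub : A ⊆ B ∪ (E ∪ h • E)) :
    A.ncard ≤ B.ncard + 2 * E.ncard := by
  refine (Set.ncard_le_ncard hsub (hB.union (hE.union hE.smul_set))).trans ?_
  refine (Set.ncard_union_le _ _).trans ?_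
  have := Set.ncard_union_le E (h • E)
  rw [Set.ncard_smul_set] at this
  omega

theorem mem_of_sideOf_eq {J : Hyperplane G} {x : V} {D : Set V} (h : J.sideOf x = D) : x ∈ D :=
  h ▸ J.mem_sideOf x

/-- If `J` separates `σ` from `h • σ` but not `x` from `h • x`, one of the two orientations chooses
the side avoiding both vertices. That side cannot contain `Y`, as the other orientation does not
choose it, so `J` is in the residual set or its translate. -/
theorem IsMedian.sep_subset_of_mem_stab (hG : IsMedian G) (x : V) {Y : Component G}
    {σ : Orientation G} (hσ : σ ∈ Y.supp) {h : G ≃g G} (hh : h ∈ stab Y) :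
    sep σ (h • σ) ⊆ sep (principal G x) (principal G (h • x)) ∪
      (residual x σ (containingAvoiding x Y) ∪ h • residual x σ (containingAvoiding x Y)) := by
  intro J hJ
  rw [MulAction.mem_stabilizer_iff] at hh
  have hhσ : h • σ ∈ Y.supp := by simpa [hh] using smul_mem_supp h hσ
  have hside : (h • σ).side J = h • σ.side (h⁻¹ • J) := rfl
  by_contra hn
  simp only [Set.mem_union, not_or] at hn
  obtain ⟨hxx, h1, h2⟩ := hn
  have hxx : J.sideOf x = J.sideOf (h • x) := not_not.1 hxx
  by_cases hx : x ∈ σ.side J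
  · rw [Set.mem_smul_set_iff_inv_smul_mem] at h2
    refine h2 ⟨fun hx' => ?_, fun hc => ?_⟩
    · have : h • x ∈ (h • σ).side J := hside ▸ Set.smul_mem_smul_set hx'
      apply hJ
      rw [← Hyperplane.sideOf_eq_of_mem ((h • σ).side_mem J) this, ← hxx]
      exact (Hyperplane.sideOf_eq_of_mem (σ.side_mem J) hx).symm
    · have hc' := hc.2.1.smul h
      rw [hh, ← hside] at hc'
      exact hJ (hG.side_eq_of_exists ((h • σ).side_mem J) (hc' σ hσ))
  · exact h1 ⟨hx, fun hc => hJ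
      (hG.side_eq_of_exists (σ.side_mem J) (hc.2.1 _ hhσ)).symm⟩

/-- If `J` separates `x` from `h • x` while `σ` and `h • σ` agree on it, their common side contains
exactly one of the two vertices. Members of `F = h • F` avoid both, so this side is not in `F`. -/
theorem IsMedian.sep_principal_subset (hG : IsMedian G) {x : V} {Y : Component G}
    (σ : Orientation G) {F : Set (Set V)} (hF : F ⊆ containingAvoiding x Y) {h : G ≃g G}
    (hh : h • F = F) :
    sep (principal G x) (principal G (h • x)) ⊆
      sep σ (h • σ) ∪ (residual x σ F ∪ h • residual x σ F) := by
  intro J hJ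
  have hside : (h • σ).side J = h • σ.side (h⁻¹ • J) := rfl
  by_contra hn
  simp only [Set.mem_union, not_or] at hn
  obtain ⟨hss, h1, h2⟩ := hn
  have hss : σ.side J = (h • σ).side J := not_not.1 hss
  by_cases hx : x ∈ σ.side J
  · rw [Set.mem_smul_set_iff_inv_smul_mem] at h2
    refine h2 ⟨fun hx' => hJ ?_, fun hc => ?_⟩
    · have hhx : h • x ∈ σ.side J := by
        rw [hss, hside]; exact Set.smul_mem_smul_set hx'
      exact (Hyperplane.sideOf_eq_of_mem (σ.side_mem J) hx).trans
        (Hyperplane.sideOf_eq_of_mem (σ.side_mem J) hhx).symm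
    · have := Set.smul_mem_smul_set (a := h) hc
      rw [hh, ← hside, ← hss] at this
      exact (hF this).2.2 hx
  · refine h1 ⟨hx, fun hc => ?_⟩
    have hxs : J.sideOf x = (σ.side J)ᶜ :=
      (hG.eq_or_eq_compl (σ.side_mem J) (J.sideOf_mem x)).resolve_left
        fun he => hx (mem_of_sideOf_eq he)
    have hhx : J.sideOf (h • x) = σ.side J :=
      (hG.eq_or_eq_compl (σ.side_mem J) (J.sideOf_mem (h • x))).resolve_right
        fun he => hJ (hxs.trans he.symm)
    rw [← hh] at hc
    obtain ⟨t, ht, hts⟩ := hc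
    have := mem_of_sideOf_eq hhx
    rw [← hts] at this
    exact (hF ht).2.2 (Set.smul_mem_smul_set_iff.1 this)

theorem dist_smul_smul_le (hG : G.Connected) (h : G ≃g G) (x y : V) :
    G.dist (h • x) (h • y) ≤ G.dist x y := by
  obtain ⟨p, hp⟩ := hG.exists_walk_length_eq_dist x y
  rw [← hp, ← SimpleGraph.Walk.length_map h.toHom p]
  exact SimpleGraph.dist_le _

theorem isElliptic_of_bounded (hG : G.Connected) {g : G ≃g G} {x : V} {N : ℕ}
    (h : ∀ n : ℤ, G.dist x ((g ^ n) • x) ≤ N) : IsElliptic g := by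
  refine fun y => ⟨G.dist y x + N + G.dist x y, fun n => ?_⟩
  have h1 := hG.dist_triangle (u := y) (v := x) (w := (g ^ n) • y)
  have h2 := hG.dist_triangle (u := x) (v := (g ^ n) • x) (w := (g ^ n) • y)
  have h3 := dist_smul_smul_le hG (g ^ n) x y
  have h4 := h n
  omega

theorem IsMedian.isEllipticOn (hG : IsMedian G) (hdim : IsFiniteDimensional G) {Y : Component G}
    {g : G ≃g G} (hg : g ∈ stab Y) (h : IsElliptic g) : IsEllipticOn g Y := by
  obtain ⟨m, hm⟩ := hdim
  obtain ⟨x⟩ := hG.connected.nonempty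
  intro σ hσ
  obtain ⟨N, hN⟩ := h x
  refine ⟨N + 2 * (residual x σ (containingAvoiding x Y)).ncard, fun n => ?_⟩
  have hgn := Subgroup.zpow_mem _ hg n
  have hmem : g ^ n • σ ∈ Y.supp := by
    simpa [MulAction.mem_stabilizer_iff.1 hgn] using smul_mem_supp (g ^ n) hσ
  rw [hG.roller_dist ((hG.mem_supp_iff hσ).1 hmem)]
  refine (ncard_le_add _ (sep_principal_finite hG.connected _ _)
    (hG.residual_finite (hG.finite_crossing hm x hσ)) (hG.sep_subset_of_mem_stab x hσ hgn)).trans ?_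
  rw [hG.ncard_sep_principal]
  exact Nat.add_le_add_right (hN n) _

theorem IsMedian.isElliptic (hG : IsMedian G) (hdim : IsFiniteDimensional G) {x : V}
    {Y : Component G} {g : stab₀ Y} (hg : g ∈ (fullHoromorphism hG.connected x Y).ker)
    (h : IsEllipticOn (g : G ≃g G) Y) : IsElliptic (g : G ≃g G) := by
  obtain ⟨F, hF, hfin, hgF⟩ := hG.exists_invariant_of_mem_ker hdim hg
  obtain ⟨m, hm⟩ := hdim
  obtain ⟨σ, hσ⟩ := Y.nonempty_supp
  obtain ⟨N, hN⟩ := h σ hσ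
  -- Two finite losses: halfspaces chosen by `σ` that do not contain `Y`, and those containing `Y`
  -- left out of `F`.
  have hres : (residual x σ F).Finite := by
    refine hG.residual_finite (((hG.finite_crossing hm x hσ).union hfin).subset fun D hD => ?_)
    by_cases hDP : D ∈ containingAvoiding x Y
    exacts [Or.inr ⟨hDP, hD.2⟩, Or.inl ⟨hD.1, hDP⟩]
  refine isElliptic_of_bounded hG.connected (x := x) (N := N + 2 * (residual x σ F).ncard)
    fun n => ?_
  have hgn : (g : G ≃g G) ^ n ∈ stab Y := Subgroup.zpow_mem _ (inf_le_left (a := stab Y) g.2) n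
  have hmem : (g : G ≃g G) ^ n • σ ∈ Y.supp := by
    simpa [MulAction.mem_stabilizer_iff.1 hgn] using smul_mem_supp ((g : G ≃g G) ^ n) hσ
  have hsep := (hG.mem_supp_iff hσ).1 hmem
  have hFn : (g : G ≃g G) ^ n • F = F :=
    MulAction.mem_stabilizer_iff.1 (Subgroup.zpow_mem _ (MulAction.mem_stabilizer_iff.2 hgF) n)
  rw [← hG.ncard_sep_principal]
  refine (ncard_le_add _ hsep hres (hG.sep_principal_subset σ hF hFn)).trans ?_
  rw [← hG.roller_dist hsep]
  exact Nat.add_le_add_right (hN n) _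

end Roller

end MedianRoller

theorem theorem3p12 {V : Type*} (G : SimpleGraph V)
    (hG : MedianRoller.IsMedian G) (hdim : MedianRoller.IsFiniteDimensional G)
    (Y : MedianRoller.Component G) (hY : MedianRoller.IsBoundary Y) :
    (MedianRoller.precSet Y).Finite ∧
    ((MedianRoller.stab₀ Y).subgroupOf (MedianRoller.stab Y)).FiniteIndex ∧
    ∀ (x : V) (g : MedianRoller.stab₀ Y),
      g ∈ (MedianRoller.fullHoromorphism hG.connected x Y).ker →
      (MedianRoller.IsElliptic (g : G ≃g G) ↔ MedianRoller.IsEllipticOn (g : G ≃g G) Y) := by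
  have hfin := hG.finite_precSet hdim Y
  exact ⟨hfin, MedianRoller.finiteIndex_stab₀ hfin, fun x g hg =>
    ⟨hG.isEllipticOn hdim (inf_le_left (a := MedianRoller.stab Y) g.2), hG.isElliptic hdim hg⟩⟩
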